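/- Let $X$ be a separable infinite-dimensional real Banach space containing no subspace isomorphic to $\ell_1$. **Moduli.** For an infinite-dimensional separable Banach space $Y$ and $0\le\sigma\le1$, let $\rho_Y(\sigma)$ be the least constant such that $\limsup_{n}\|x+x_n\|\le 1+\rho_Y(\sigma)$ whenever $x,x_n\in Y$, $\|x\|=1$, $x_n\to0$ weakly and $\limsup_n\|x_n\|\le\sigma$. For $0\le\tau\le1$ let $\theta_Y(\tau)$ be the greatest constant such that $\liminf_n\|x^*+x_n^*\|\ge1+\theta_Y(\tau)$ whenever $x^*,x_n^*\in Y^*$, $\|x^*\|=1$, $x_n^*\to0$ weak$^*$ and $\liminf_n\|x_n^*\|\ge\tau$. Put $\rho=\rho_X$, $\theta=\theta_X$, $\varphi(\sigma)=\inf\{\rho_Y(\sigma): d(X,Y)\le2\}$ and $\psi(\tau)=\sup\{\theta_Y(\tau): d(X,Y)\le2\}$, where $Y$ ranges over Banach spaces and $d(X,Y)=\inf\{\|T\|\,\|T^{-1}\|: T:X\to Y\text{ an isomorphism}\}$ is the Banach–Mazur distance ($\infty$ if $X,Y$ are not isomorphic). **Equivalence and duality.** Let $f,g$ be continuous monotone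 increasing functions on $[0,1]$ with $f(0)=g(0)=0$. For $C\geq 1$, $f$ *$C$-dominates* $g$ if $f(\tau)\ge g(\tau/C)$ for all $0\le\tau\le1$, and $f,g$ are *$C$-equivalent* if each $C$-dominates the other. The dual Young function is $f^*(s)=\sup\{st-f(t):0\le t\le1\}$. **Convex Szlenk index.** For $\epsilon>0$ and $K\subset X^*$ weak$^*$-compact and convex, let $\iota_\epsilon K$ be $K$ with all weak$^*$-open sets $V$ such that $\operatorname{diam}(V\cap K)\le\epsilon$ removed, and let $\hat\iota_\epsilon K$ be the weak$^*$-closed convex hull of $\iota_\epsilon K$. Then $\mathrm{Cz}(X,\epsilon)$ is the least $n\in\mathbb N$ with $\hat\iota_\epsilon^{\,n}B_{X^*}=\emptyset$, and $\infty$ if there is no such $n$. Then: 1. Each of the functions $\rho(t)/t$, $\theta(t)/t$, $\varphi(t)/t$ and $\psi(t)/t$ is monotone increasing (non-strictly) on $(0,1)$. 2. $\theta$ is $4$-equivalent to $\rho^*$, and $\psi$ is $4$-equivalent to $\varphi^*$ (in particular all these functions are continuous and monotone increasing on $[0,1]$ and vanish at $0$). 3. $\rho$ is $8$-equivalent to $\theta^*$,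 and $\varphi$ is $8$-equivalent to $\psi^*$ (again, the functions are continuous and monotone increasing on $[0,1]$ and vanish at $0$). 4. For $0<t\le1$, $\mathrm{Cz}(X,t)\le 1+\dfrac1{\psi(t/4)}$, where the right-hand side is $\infty$ if $\psi(t/4)=0$. -/

import Mathlib

open Set Filter Topology
open scoped ENNReal

noncomputable section

namespace AsymptoticModuli

universe u

/-- `X` contains `ℓ₁`: some linear subspace of `X` is linearly homeomorphic to the space `ℓ₁` of
absolutely summable real sequences. -/
def ContainsEllOne (X : Type u) [NormedAddCommGroup X] [NormedSpace ℝ X] : Prop :=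
  ∃ Z : Submodule ℝ X, Nonempty (lp (fun _ : ℕ => ℝ) 1 ≃L[ℝ] Z)

/-- The Banach-Mazur distance, the infimum of `‖T‖ * ‖T⁻¹‖` over all linear homeomorphisms `T` from
`X` onto `Y`; it is `∞` if there are none. -/
def banachMazurDist (X Y : Type u) [NormedAddCommGroup X] [NormedSpace ℝ X]
    [NormedAddCommGroup Y] [NormedSpace ℝ Y] : ℝ≥0∞ :=
  ⨅ T : X ≃L[ℝ] Y, ENNReal.ofReal (‖(T : X →L[ℝ] Y)‖ * ‖(T.symm : Y →L[ℝ] X)‖)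

/-! ### The asymptotic moduli -/

/-- The sequence `u` converges to `0` weakly. -/
def WeaklyNull {X : Type u} [NormedAddCommGroup X] [NormedSpace ℝ X] (u : ℕ → X) : Prop :=
  ∀ f : StrongDual ℝ X, Tendsto (fun n => f (u n)) atTop (𝓝 0)

/-- The sequence `f` of functionals converges to `0` weak*. -/
def WeakStarNull {X : Type u} [NormedAddCommGroup X] [NormedSpace ℝ X]
    (f : ℕ → StrongDual ℝ X) : Prop :=
  ∀ x : X, Tendsto (fun n => f n x) atTop (𝓝 0)

/-- `ρ_X(σ)`, the least constant `c` such that `limsup ‖x + xₙ‖ ≤ 1 + c` whenever `‖x‖ = 1`,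
`xₙ → 0` weakly and `limsup ‖xₙ‖ ≤ σ`. (Weakly null sequences are bounded, so that the upper limits
of real sequences are the true ones.) -/
def rho (X : Type u) [NormedAddCommGroup X] [NormedSpace ℝ X] (σ : ℝ) : ℝ :=
  sInf {c : ℝ | ∀ (x : X) (u : ℕ → X), ‖x‖ = 1 → WeaklyNull u →
    limsup (fun n => ‖u n‖) atTop ≤ σ → limsup (fun n => ‖x + u n‖) atTop ≤ 1 + c}

/-- `θ_X(τ)`, the greatest constant `c` such that `liminf ‖x* + xₙ*‖ ≥ 1 + c` whenever `‖x*‖ = 1`,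
`xₙ* → 0` weak* and `liminf ‖xₙ*‖ ≥ τ`. (Weak* null sequences are bounded if `X` is complete.) -/
def theta (X : Type u) [NormedAddCommGroup X] [NormedSpace ℝ X] (τ : ℝ) : ℝ :=
  sSup {c : ℝ | ∀ (f : StrongDual ℝ X) (g : ℕ → StrongDual ℝ X), ‖f‖ = 1 → WeakStarNull g →
    τ ≤ liminf (fun n => ‖g n‖) atTop → 1 + c ≤ liminf (fun n => ‖f + g n‖) atTop}

/-- `φ_X(σ)`, the infimum of `ρ_Y(σ)` over all Banach spaces `Y` with `d(X, Y) ≤ 2`. -/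
def phi (X : Type u) [NormedAddCommGroup X] [NormedSpace ℝ X] (σ : ℝ) : ℝ :=
  sInf {r : ℝ | ∃ (Y : Type u) (_ : NormedAddCommGroup Y) (_ : NormedSpace ℝ Y)
    (_ : CompleteSpace Y), banachMazurDist X Y ≤ 2 ∧ r = rho Y σ}

/-- `ψ_X(τ)`, the supremum of `θ_Y(τ)` over all Banach spaces `Y` with `d(X, Y) ≤ 2`. -/
def psi (X : Type u) [NormedAddCommGroup X] [NormedSpace ℝ X] (τ : ℝ) : ℝ :=
  sSup {r : ℝ | ∃ (Y : Type u) (_ : NormedAddCommGroup Y) (_ : NormedSpace ℝ Y)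
    (_ : CompleteSpace Y), banachMazurDist X Y ≤ 2 ∧ r = theta Y τ}

/-! ### Young duality and equivalence of functions on `[0, 1]` -/

/-- The dual Young function `f^*(s) = sup {s t - f(t) : 0 ≤ t ≤ 1}`. -/
def youngDual (f : ℝ → ℝ) (s : ℝ) : ℝ :=
  sSup ((fun t => s * t - f t) '' Icc 0 1)

/-- The functions that domination and equivalence are about: continuous and monotone increasing on
`[0, 1]`, with value `0` at `0`. -/
structure IsModulus (f : ℝ → ℝ) : Prop where
  continuousOn : ContinuousOn f (Icc 0 1)
  monotoneOn : MonotoneOn f (Icc 0 1)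
  map_zero : f 0 = 0

/-- `f` `C`-dominates `g`. -/
def Dominates (C : ℝ) (f g : ℝ → ℝ) : Prop :=
  ∀ τ ∈ Icc (0 : ℝ) 1, g (τ / C) ≤ f τ

/-- `f` and `g` are `C`-equivalent. -/
structure Equivalent (C : ℝ) (f g : ℝ → ℝ) : Prop where
  isModulus_left : IsModulus f
  isModulus_right : IsModulus g
  dominates : Dominates C f g
  dominated : Dominates C g f

/-! ### The convex Szlenk index -/

/-- `ι_ε K`: the points of `K` that are in no weak*-open set `V` such that `V ∩ K` has diameter
at most `ε` in the dual norm. -/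
def szlenkDerivation {X : Type u} [NormedAddCommGroup X] [NormedSpace ℝ X] (ε : ℝ)
    (K : Set (WeakDual ℝ X)) : Set (WeakDual ℝ X) :=
  K \ ⋃₀ {V | IsOpen V ∧
    Metric.ediam (WeakDual.toStrongDual '' (V ∩ K)) ≤ ENNReal.ofReal ε}

/-- The weak*-closed convex hull of `ι_ε K`. -/
def convexSzlenkDerivation {X : Type u} [NormedAddCommGroup X] [NormedSpace ℝ X] (ε : ℝ)
    (K : Set (WeakDual ℝ X)) : Set (WeakDual ℝ X) :=
  closure (convexHull ℝ (szlenkDerivation ε K))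

/-- The convex Szlenk index `Cz(X, ε)`: the least `n` such that `n` convex derivations turn the dual
unit ball into the empty set, and `∞` if no finite number of them does. -/
def Cz (X : Type u) [NormedAddCommGroup X] [NormedSpace ℝ X] (ε : ℝ) : ℕ∞ :=
  ⨅ (n : ℕ) (_ : (convexSzlenkDerivation ε)^[n]
    (WeakDual.toStrongDual ⁻¹' Metric.closedBall (0 : StrongDual ℝ X) 1) = ∅), (n : ℕ∞)

end AsymptoticModuli

end

open AsymptoticModuli

/-!
The moduli are tied together by two inequalities, valid for every separable infinite-dimensional
Banach space without `ℓ₁`: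

* `1 + st/2 ≤ (1 + ρ(s)) (1 + θ(t))` (`one_add_mul_le_rho_theta`). Test `f + g n` against
  `x + s • u n`, where `x` norms `f` and `u` is a weakly null sequence in the unit ball that norms
  the weak* null sequence `g` up to a factor `2`. Such a `u` consists of halves of differences of
  vectors norming `g`, after passing to a weakly Cauchy subsequence; this is the place of Rosenthal's
  `ℓ₁` theorem (`exists_weaklyCauchy_subseq`), which rests on the combinatorial lemma
  `Rich.exists_refine`.
* `ρ(θ(t)/t) ≤ θ(t)` (`rho_theta_div_le`). Norm `x + u n` by functionals and extract a weak*
  convergent subsequence; `θ` limits how far the norming functionals can be from their limit.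

Moreover all moduli are `1`-Lipschitz, and `f(t)/t` is increasing by convexity of the norm along
segments (`isConvexlikeModulus_rho`, `isConvexlikeModulus_theta`). All these properties pass from the
pairs `(ρ_Y, θ_Y)` to the infimum of the `ρ_Y` and the supremum of the `θ_Y`
(`DualModuli.of_isGLB_of_isLUB`), so that they hold for `(φ, ψ)` too, and they imply the equivalences
with the Young duals by elementary calculus (`DualModuli.equivalent_four`,
`DualModuli.equivalent_eight`).

For the Szlenk index, transport the norm of a space `Y` with `d(X, Y) ≤ 2` to `X`. A point `f` of a
Szlenk derivation of a set `K` is the weak* limit of points of `K` that are at distance more than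
`t/2` from `f`, hence at distance more than about `t/4` in the transported dual norm. By the definition
of `θ_Y`, each convex derivation therefore shrinks the radius of the transported dual ball by
`θ_Y(t/4)`, up to an arbitrarily small error (`convexSzlenkDerivation_subset`).
-/

namespace AsymptoticModuli

/-! ### Functions on the unit interval and Young duality -/

/-- The properties shared by the four moduli: value `0` at `0`, monotone and `1`-Lipschitz on
`[0, 1]`, and `f(t)/t` monotone increasing (stated without division). -/
structure IsConvexlikeModulus (f : ℝ → ℝ) : Prop where
  map_zero : f 0 = 0
  mono : ∀ ⦃s t⦄, 0 ≤ s → s ≤ t → t ≤ 1 → f s ≤ f t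
  lip : ∀ ⦃s t⦄, 0 ≤ s → s ≤ t → t ≤ 1 → f t ≤ f s + (t - s)
  star : ∀ ⦃s t⦄, 0 < s → s ≤ t → t ≤ 1 → t * f s ≤ s * f t

namespace IsConvexlikeModulus

variable {f : ℝ → ℝ}

lemma nonneg (hf : IsConvexlikeModulus f) {t : ℝ} (h0 : 0 ≤ t) (h1 : t ≤ 1) : 0 ≤ f t :=
  hf.map_zero ▸ hf.mono le_rfl h0 h1

lemma le_self (hf : IsConvexlikeModulus f) {t : ℝ} (h0 : 0 ≤ t) (h1 : t ≤ 1) : f t ≤ t := by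
  have := hf.lip le_rfl h0 h1
  rw [hf.map_zero] at this
  linarith

end IsConvexlikeModulus

lemma continuousOn_of_lip {f : ℝ → ℝ}
    (mono : ∀ ⦃s t⦄, 0 ≤ s → s ≤ t → t ≤ 1 → f s ≤ f t)
    (lip : ∀ ⦃s t⦄, 0 ≤ s → s ≤ t → t ≤ 1 → f t ≤ f s + (t - s)) :
    ContinuousOn f (Icc 0 1) := by
  have : LipschitzOnWith 1 f (Icc 0 1) := by
    refine LipschitzOnWith.of_dist_le_mul fun x hx y hy => ?_
    rw [Real.dist_eq, Real.dist_eq, NNReal.coe_one, one_mul]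
    rcases le_total x y with h | h
    · rw [abs_sub_comm, abs_sub_comm x y, abs_of_nonneg (sub_nonneg.2 (mono hx.1 h hy.2)),
        abs_of_nonneg (sub_nonneg.2 h)]
      linarith [lip hx.1 h hy.2]
    · rw [abs_of_nonneg (sub_nonneg.2 (mono hy.1 h hx.2)), abs_of_nonneg (sub_nonneg.2 h)]
      linarith [lip hy.1 h hx.2]
  exact this.continuousOn

lemma IsConvexlikeModulus.isModulus {f : ℝ → ℝ} (hf : IsConvexlikeModulus f) : IsModulus f where
  continuousOn := continuousOn_of_lip hf.mono hf.lip
  monotoneOn := fun _ hx _ hy h => hf.mono hx.1 h hy.2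
  map_zero := hf.map_zero

lemma IsConvexlikeModulus.monotoneOn_div {f : ℝ → ℝ} (hf : IsConvexlikeModulus f) :
    MonotoneOn (fun t => f t / t) (Ioo 0 1) := by
  intro s hs t ht h
  rw [div_le_div_iff₀ hs.1 ht.1]
  linarith [hf.star hs.1 h ht.2.le]

section youngDual

variable {f : ℝ → ℝ} (hf : IsConvexlikeModulus f)
include hf

lemma bddAbove_youngDual (s : ℝ) : BddAbove ((fun t => s * t - f t) '' Icc 0 1) := by
  refine ⟨|s|, ?_⟩
  rintro _ ⟨t, ht, rfl⟩
  have h1 : s * t ≤ |s| * 1 :=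
    (mul_le_mul_of_nonneg_right (le_abs_self s) ht.1).trans
      (mul_le_mul_of_nonneg_left ht.2 (abs_nonneg s))
  have := hf.nonneg ht.1 ht.2
  simp only
  linarith

lemma le_youngDual {s t : ℝ} (h0 : 0 ≤ t) (h1 : t ≤ 1) : s * t - f t ≤ youngDual f s :=
  le_csSup (bddAbove_youngDual hf s) ⟨t, ⟨h0, h1⟩, rfl⟩

omit hf in
lemma youngDual_le {s c : ℝ} (h : ∀ t, 0 ≤ t → t ≤ 1 → s * t - f t ≤ c) : youngDual f s ≤ c := by
  refine csSup_le ((nonempty_Icc.2 zero_le_one).image _) ?_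
  rintro _ ⟨t, ht, rfl⟩
  exact h t ht.1 ht.2

lemma youngDual_nonneg (s : ℝ) : 0 ≤ youngDual f s := by
  simpa [hf.map_zero] using le_youngDual hf (s := s) le_rfl zero_le_one

lemma isModulus_youngDual : IsModulus (youngDual f) := by
  have mono : ∀ ⦃s t⦄, 0 ≤ s → s ≤ t → t ≤ 1 → youngDual f s ≤ youngDual f t := by
    intro s t _ hst _
    refine youngDual_le fun r h0 h1 => ?_
    have := le_youngDual hf (s := t) h0 h1
    nlinarith
  refine ⟨continuousOn_of_lip mono ?_, fun _ hx _ hy h => mono hx.1 h hy.2, ?_⟩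
  · intro s t _ hst _
    refine youngDual_le fun r h0 h1 => ?_
    have := le_youngDual hf (s := s) h0 h1
    nlinarith
  · refine le_antisymm (youngDual_le fun t h0 h1 => ?_) (youngDual_nonneg hf 0)
    linarith [hf.nonneg h0 h1]

end youngDual

lemma IsModulus.mono_div {f : ℝ → ℝ} (hf : IsModulus f) {s a b : ℝ} (hs : s ∈ Icc (0 : ℝ) 1)
    (ha : 1 ≤ a) (hab : a ≤ b) : f (s / b) ≤ f (s / a) := by
  have hle : s / b ≤ s / a := div_le_div_of_nonneg_left hs.1 (by linarith) hab
  have h1 : s / a ≤ 1 := (div_le_self hs.1 ha).trans hs.2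
  exact hf.monotoneOn ⟨div_nonneg hs.1 (by linarith), hle.trans h1⟩
    ⟨div_nonneg hs.1 (by linarith), h1⟩ hle

/-- The two inequalities that tie the modulus `r` of a space to the modulus `h` of its dual. -/
structure DualModuli (r h : ℝ → ℝ) : Prop where
  left : IsConvexlikeModulus r
  right : IsConvexlikeModulus h
  mul_ge : ∀ ⦃s t⦄, 0 ≤ s → s ≤ 1 → 0 ≤ t → t ≤ 1 → 1 + s * t / 2 ≤ (1 + r s) * (1 + h t)
  apply_div_le : ∀ ⦃t⦄, 0 < t → t ≤ 1 → r (h t / t) ≤ h t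

namespace DualModuli

variable {r h : ℝ → ℝ} (H : DualModuli r h)
include H

/-- The additive form of `mul_ge`. -/
lemma add_ge {s t : ℝ} (hs0 : 0 ≤ s) (hs1 : s ≤ 1) (ht0 : 0 ≤ t) (ht1 : t ≤ 1) :
    s * t / 4 ≤ r s + h t := by
  have h1 := H.mul_ge hs0 hs1 ht0 ht1
  have h2 := H.left.nonneg hs0 hs1
  have h3 := H.right.nonneg ht0 ht1
  have h4 := H.left.le_self hs0 hs1
  have h5 := H.right.le_self ht0 ht1
  have h6 : r s * h t ≤ r s := mul_le_of_le_one_right h2 (h5.trans ht1)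
  have h7 : r s * h t ≤ h t := mul_le_of_le_one_left h3 (h4.trans hs1)
  linarith

lemma equivalent_four : Equivalent 4 h (youngDual r) where
  isModulus_left := H.right.isModulus
  isModulus_right := isModulus_youngDual H.left
  dominates := by
    intro t ht
    refine youngDual_le fun s h0 h1 => ?_
    linarith [H.add_ge h0 h1 ht.1 ht.2]
  dominated := by
    intro t ht
    rcases ht.1.eq_or_lt with rfl | hpos
    · simpa [H.right.map_zero] using youngDual_nonneg H.left 0
    -- The witness in the supremum is `h(t/4) / (t/4)`.
    have hσ : 0 < t / 4 := by positivity
    have hσ1 : t / 4 ≤ 1 := by linarith [ht.2]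
    have hle := H.right.le_self hσ.le hσ1
    have hnn := H.right.nonneg hσ.le hσ1
    have := le_youngDual H.left (s := t) (div_nonneg hnn hσ.le) ((div_le_one hσ).2 hle)
    have h2 := H.apply_div_le hσ hσ1
    have h3 : t * (h (t / 4) / (t / 4)) = 4 * h (t / 4) := by field_simp
    linarith

/-- The witness in the supremum defining `h^*(s)` is a solution `t` of `h(t)/t = s/2`. -/
lemma apply_half_le_youngDual {s : ℝ} (hs : s ∈ Icc (0 : ℝ) 1) : r (s / 2) ≤ youngDual h s := by
  have hs2 : s / 2 ≤ 1 := by linarith [hs.2]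
  have hs0 : 0 ≤ s / 2 := by linarith [hs.1]
  by_cases h1 : h 1 ≤ s / 2
  · have := le_youngDual H.right (s := s) zero_le_one le_rfl
    linarith [H.left.le_self hs0 hs2]
  push Not at h1
  by_cases h2 : ∃ t, 0 < t ∧ t ≤ 1 ∧ h t ≤ s / 2 * t
  · obtain ⟨a, ha0, ha1, ha⟩ := h2
    have hc : ContinuousOn (fun t => h t - s / 2 * t) (Icc a 1) :=
      (H.right.isModulus.continuousOn.mono (Icc_subset_Icc ha0.le le_rfl)).sub
        (continuous_const.mul continuous_id).continuousOn
    obtain ⟨t, ht, hte⟩ := intermediate_value_Icc ha1 hc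
      (show (0 : ℝ) ∈ Icc _ _ from ⟨by linarith, by linarith⟩)
    have hte : h t = s / 2 * t := by simp only at hte; linarith
    have ht0 : 0 < t := ha0.trans_le ht.1
    have h3 := H.apply_div_le ht0 ht.2
    rw [hte, mul_div_cancel_right₀ _ ht0.ne'] at h3
    have := le_youngDual H.right (s := s) ht0.le ht.2
    rw [hte] at this
    linarith
  · push Not at h2
    refine le_trans ?_ (youngDual_nonneg H.right s)
    refine le_of_forall_pos_le_add fun ε hε => ?_
    have ht0 : 0 < min ε 1 := lt_min hε one_pos
    have h3 := H.apply_div_le ht0 (min_le_right _ _)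
    have h4 := h2 _ ht0 (min_le_right _ _)
    have h5 := H.right.le_self ht0.le (min_le_right _ _)
    have h6 := H.left.mono hs0 ((le_div_iff₀ ht0).2 h4.le) ((div_le_one ht0).2 h5)
    linarith [min_le_left ε 1]

lemma equivalent_eight : Equivalent 8 r (youngDual h) where
  isModulus_left := H.left.isModulus
  isModulus_right := isModulus_youngDual H.right
  dominates := by
    intro s hs
    refine ((isModulus_youngDual H.right).mono_div hs (a := 4) (by norm_num) (by norm_num)).trans ?_
    refine youngDual_le fun t h0 h1 => ?_
    linarith [H.add_ge hs.1 hs.2 h0 h1]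
  dominated := by
    intro s hs
    exact (H.left.isModulus.mono_div hs (a := 2) (by norm_num) (by norm_num)).trans
      (H.apply_half_le_youngDual hs)

end DualModuli

/-! ### The combinatorial core of Rosenthal's theorem -/

/-- Successive choices `m 0 < m 1 < ...` of natural numbers from a decreasing sequence of infinite
sets `L 0 ⊇ L 1 ⊇ ...`, together with states `a i`. -/
lemma exists_strictMono_of_step {σ : Type*} (Inv : σ → Set ℕ → Prop)
    (R : σ → ℕ → σ → Set ℕ → Prop)
    (step : ∀ a M, M.Infinite → Inv a M → ∃ m ∈ M, ∃ b, ∃ L ⊆ M, L.Infinite ∧ (∀ l ∈ L, m < l) ∧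
      Inv b L ∧ R a m b L)
    {a₀ : σ} {M₀ : Set ℕ} (hM₀ : M₀.Infinite) (h₀ : Inv a₀ M₀) :
    ∃ (m : ℕ → ℕ) (a : ℕ → σ) (L : ℕ → Set ℕ), StrictMono m ∧ a 0 = a₀ ∧ L 0 = M₀ ∧
      (∀ i, (L i).Infinite ∧ Inv (a i) (L i)) ∧
      (∀ i, R (a i) (m i) (a (i + 1)) (L (i + 1))) ∧ ∀ i j, i ≤ j → m j ∈ L i := by
  have key : ∀ p : {p : σ × Set ℕ // p.2.Infinite ∧ Inv p.1 p.2}, ∃ m ∈ p.1.2,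
      ∃ q : {p : σ × Set ℕ // p.2.Infinite ∧ Inv p.1 p.2}, q.1.2 ⊆ p.1.2 ∧
        (∀ l ∈ q.1.2, m < l) ∧ R p.1.1 m q.1.1 q.1.2 := by
    rintro ⟨⟨a, M⟩, hM, hI⟩
    obtain ⟨m, hm, b, L, hL, hLi, hlt, hb, hR⟩ := step a M hM hI
    exact ⟨m, hm, ⟨⟨b, L⟩, hLi, hb⟩, hL, hlt, hR⟩
  choose μ hμ nx hsub hlt hR using key
  let p : ℕ → {p : σ × Set ℕ // p.2.Infinite ∧ Inv p.1 p.2} :=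
    fun n => Nat.rec ⟨⟨a₀, M₀⟩, hM₀, h₀⟩ (fun _ q => nx q) n
  have anti : Antitone fun i => (p i).1.2 := antitone_nat_of_succ_le fun i => hsub (p i)
  refine ⟨fun i => μ (p i), fun i => (p i).1.1, fun i => (p i).1.2, ?_, rfl, rfl,
    fun i => (p i).2, fun i => hR (p i), fun i j hij => anti hij (hμ (p j))⟩
  exact strictMono_nat_of_lt_succ fun i => hlt (p i) _ (hμ (p (i + 1)))

/-- `s` lies in infinitely many `A n` and in infinitely many `B n` with `n ∈ M`. -/
def Straddles {S : Type*} (A B : ℕ → Set S) (M : Set ℕ) (s : S) : Prop :=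
  {n ∈ M | s ∈ A n}.Infinite ∧ {n ∈ M | s ∈ B n}.Infinite

/-- Every infinite subset of `M` is straddled by some point of `D`. -/
def Rich {S : Type*} (A B : ℕ → Set S) (D : Set S) (M : Set ℕ) : Prop :=
  ∀ L ⊆ M, L.Infinite → ∃ s ∈ D, Straddles A B L s

variable {S : Type*} {A B : ℕ → Set S}

lemma Straddles.of_diff_finite {M L : Set ℕ} {s : S} (h : Straddles A B M s)
    (hfin : (M \ L).Finite) : Straddles A B L s := by
  constructor
  · refine (h.1.sdiff hfin).mono fun n hn => ⟨?_, hn.1.2⟩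
    by_contra hL
    exact hn.2 ⟨hn.1.1, hL⟩
  · refine (h.2.sdiff hfin).mono fun n hn => ⟨?_, hn.1.2⟩
    by_contra hL
    exact hn.2 ⟨hn.1.1, hL⟩

lemma Rich.mono {D : Set S} {M L : Set ℕ} (h : Rich A B D M) (hL : L ⊆ M) : Rich A B D L :=
  fun N hN hi => h N (hN.trans hL) hi

lemma infinite_inter_Ioi {M : Set ℕ} (hM : M.Infinite) (m : ℕ) : (M ∩ Ioi m).Infinite := by
  refine (hM.sdiff (finite_Iic m)).mono fun n hn => ⟨hn.1, ?_⟩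
  simpa using hn.2

/-- Finitely many sets that are rich on `M` can be refined simultaneously by `A m` and by `B m` for
some `m ∈ M`. Otherwise each member of some infinite subset of `M` spoils the richness of one of
finitely many sets on the members that follow it; a set spoilt infinitely often, always on the same
side, would not be rich. -/
lemma Rich.exists_refine {𝒟 : Set (Set S)} (hfin : 𝒟.Finite) {M : Set ℕ} (hM : M.Infinite)
    (hr : ∀ D ∈ 𝒟, Rich A B D M) :
    ∃ m ∈ M, ∃ L ⊆ M, L.Infinite ∧ (∀ l ∈ L, m < l) ∧
      ∀ D ∈ 𝒟, Rich A B (D ∩ A m) L ∧ Rich A B (D ∩ B m) L := by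
  by_contra hcon
  push Not at hcon
  have spoil : ∀ N ⊆ M, N.Infinite → ∃ m ∈ N, ∃ c : 𝒟 × Bool, ∃ L ⊆ N, L.Infinite ∧
      (∀ l ∈ L, m < l) ∧ ∀ s ∈ c.1.1 ∩ (if c.2 then A m else B m), ¬ Straddles A B L s := by
    intro N hN hNi
    obtain ⟨m, hm⟩ := hNi.nonempty
    obtain ⟨D, hD, h⟩ := hcon m (hN hm) (N ∩ Ioi m) (inter_subset_left.trans hN)
      (infinite_inter_Ioi hNi m) (fun l hl => hl.2)
    refine ⟨m, hm, ?_⟩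
    by_cases hA : Rich A B (D ∩ A m) (N ∩ Ioi m)
    · have hB := h hA
      simp only [Rich, not_forall] at hB
      obtain ⟨L, hL, hLi, hs⟩ := hB
      exact ⟨(⟨D, hD⟩, false), L, hL.trans inter_subset_left, hLi, fun l hl => (hL hl).2,
        fun s hs' hst => hs ⟨s, by simpa using hs', hst⟩⟩
    · simp only [Rich, not_forall] at hA
      obtain ⟨L, hL, hLi, hs⟩ := hA
      exact ⟨(⟨D, hD⟩, true), L, hL.trans inter_subset_left, hLi, fun l hl => (hL hl).2,
        fun s hs' hst => hs ⟨s, by simpa using hs', hst⟩⟩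
  obtain ⟨-, -, c₀, -⟩ := spoil M subset_rfl hM
  obtain ⟨m, a, L, hm, -, hL0, hL, hR, hmL⟩ := exists_strictMono_of_step
    (fun (_ : 𝒟 × Bool) N => N ⊆ M)
    (fun _ m c L => ∀ s ∈ c.1.1 ∩ (if c.2 then A m else B m), ¬ Straddles A B L s)
    (fun _ N hNi hN => by
      obtain ⟨m, hm, c, L, hL, hLi, hlt, h⟩ := spoil N hN hNi
      exact ⟨m, hm, c, L, hL, hLi, hlt, hL.trans hN, h⟩) (a₀ := c₀) hM subset_rfl
  have : Finite 𝒟 := hfin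
  obtain ⟨c, hc⟩ := Finite.exists_infinite_fiber fun i => a (i + 1)
  have hI : ((fun i => a (i + 1)) ⁻¹' {c}).Infinite := infinite_coe_iff.1 hc
  have hNi := hI.image hm.injective.injOn
  obtain ⟨s, hsD, hs⟩ := hr c.1.1 c.1.2 _ (by
    rintro _ ⟨i, -, rfl⟩
    exact (hL 0).2 (hmL 0 i (Nat.zero_le i))) hNi
  obtain ⟨i, hi, hsi⟩ : ∃ i, a (i + 1) = c ∧ s ∈ (if c.2 then A (m i) else B (m i)) := by
    cases hc2 : c.2
    · obtain ⟨_, ⟨i, hi, rfl⟩, h⟩ := hs.2.nonempty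
      exact ⟨i, hi, by simpa using h⟩
    · obtain ⟨_, ⟨i, hi, rfl⟩, h⟩ := hs.1.nonempty
      exact ⟨i, hi, by simpa using h⟩
  refine hR i s ?_ (hs.of_diff_finite ?_)
  · rw [hi]
    exact ⟨hsD, hsi⟩
  · refine ((finite_Iic i).image m).subset ?_
    rintro _ ⟨⟨j, -, rfl⟩, hj⟩
    refine ⟨j, ?_, rfl⟩
    by_contra hij
    exact hj (hmL (i + 1) j (Nat.succ_le_of_lt (by simpa using hij)))

/-- Richness yields a subsequence of pairs that are independent in the sense of Rosenthal. -/
lemma Rich.exists_independent {D : Set S} {M : Set ℕ} (hM : M.Infinite) (hr : Rich A B D M) :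
    ∃ m : ℕ → ℕ, ∀ (ε : ℕ → Bool) (n : ℕ),
      ∃ s ∈ D, ∀ i < n, s ∈ (if ε i then A (m i) else B (m i)) := by
  obtain ⟨m, a, L, hm, ha0, -, hL, hR, -⟩ := exists_strictMono_of_step
    (fun (𝒟 : Set (Set S)) M => 𝒟.Finite ∧ ∀ D ∈ 𝒟, Rich A B D M)
    (fun 𝒟 m 𝒟' _ => ∀ D ∈ 𝒟, D ∩ A m ∈ 𝒟' ∧ D ∩ B m ∈ 𝒟')
    (fun 𝒟 M hM h => by
      obtain ⟨m, hm, L, hL, hLi, hlt, hD⟩ := Rich.exists_refine h.1 hM h.2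
      refine ⟨m, hm, (· ∩ A m) '' 𝒟 ∪ (· ∩ B m) '' 𝒟, L, hL, hLi, hlt,
        ⟨(h.1.image _).union (h.1.image _), ?_⟩,
        fun D hD => ⟨Or.inl ⟨D, hD, rfl⟩, Or.inr ⟨D, hD, rfl⟩⟩⟩
      rintro _ (⟨E, hE, rfl⟩ | ⟨E, hE, rfl⟩)
      exacts [(hD E hE).1, (hD E hE).2]) (a₀ := {D}) hM ⟨finite_singleton D, by simpa using hr⟩
  refine ⟨m, fun ε n => ?_⟩
  have mem : ∀ n, {s ∈ D | ∀ i < n, s ∈ (if ε i then A (m i) else B (m i))} ∈ a n := by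
    intro n
    induction n with
    | zero => simp [ha0]
    | succ n ih =>
      have heq : {s ∈ D | ∀ i < n + 1, s ∈ (if ε i then A (m i) else B (m i))} =
          {s ∈ D | ∀ i < n, s ∈ (if ε i then A (m i) else B (m i))} ∩
            (if ε n then A (m n) else B (m n)) := by
        ext s
        simp only [mem_ofPred_eq, mem_inter_iff, Nat.lt_succ_iff_lt_or_eq, or_imp, forall_and,
          forall_eq, and_assoc]
      rw [heq]
      cases ε n
      · simpa using (hR n _ ih).2
      · simpa using (hR n _ ih).1
  obtain ⟨s, hs, -⟩ := (hL n).2.2 _ (mem n) (L n) subset_rfl (hL n).1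
  exact ⟨s, hs.1, hs.2⟩

/-! ### Rosenthal's theorem -/

section Rosenthal

variable {X : Type*} [NormedAddCommGroup X] [NormedSpace ℝ X]

/-- A bounded sequence with a lower `ℓ₁` estimate spans a copy of `ℓ₁`. -/
lemma containsEllOne_of_lower_bound [CompleteSpace X] {x : ℕ → X} {C δ : ℝ} (hb : ∀ n, ‖x n‖ ≤ C)
    (hδ : 0 < δ)
    (h : ∀ (a : ℕ → ℝ) (n : ℕ),
      δ * ∑ i ∈ Finset.range n, |a i| ≤ ‖∑ i ∈ Finset.range n, a i • x i‖) :
    ContainsEllOne X := by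
  have hs : ∀ a : lp (fun _ : ℕ => ℝ) 1, HasSum (fun i => |a i|) ‖a‖ := by
    intro a
    have := lp.hasSum_norm (p := 1) (by simp) a
    simpa using this
  have hsx : ∀ a : lp (fun _ : ℕ => ℝ) 1, Summable (fun i => a i • x i) := by
    intro a
    refine Summable.of_norm_bounded ((hs a).summable.mul_right C) fun i => ?_
    rw [norm_smul, Real.norm_eq_abs]
    exact mul_le_mul_of_nonneg_left (hb i) (abs_nonneg _)
  let T₀ : lp (fun _ : ℕ => ℝ) 1 →ₗ[ℝ] X :=
    { toFun := fun a => ∑' i, a i • x i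
      map_add' := fun a b => by
        rw [← (hsx a).tsum_add (hsx b)]
        simp [add_smul]
      map_smul' := fun c a => by
        simp only [RingHom.id_apply]
        rw [← (hsx a).tsum_const_smul c]
        simp [smul_smul] }
  have upper : ∀ a, ‖T₀ a‖ ≤ C * ‖a‖ := by
    intro a
    rw [mul_comm]
    refine tsum_of_norm_bounded ((hs a).mul_right C) fun i => ?_
    rw [norm_smul, Real.norm_eq_abs]
    exact mul_le_mul_of_nonneg_left (hb i) (abs_nonneg _)
  have lower : ∀ a, δ * ‖a‖ ≤ ‖T₀ a‖ := fun a =>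
    le_of_tendsto_of_tendsto' ((hs a).tendsto_sum_nat.const_mul δ)
      ((hsx a).hasSum.tendsto_sum_nat.norm) (h fun i => a i)
  let T := T₀.mkContinuous C upper
  have anti : AntilipschitzWith (Real.toNNReal δ⁻¹) T := by
    refine T.antilipschitz_of_bound fun a => ?_
    rw [Real.coe_toNNReal _ (inv_nonneg.2 hδ.le), inv_mul_eq_div, le_div_iff₀ hδ, mul_comm]
    exact lower a
  exact ⟨_, ⟨T.equivRange anti.injective (anti.isClosed_range T.uniformContinuous)⟩⟩

lemma ContainsEllOne.of_equiv {Y : Type*} [NormedAddCommGroup Y] [NormedSpace ℝ Y]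
    (T : Y ≃L[ℝ] X) (h : ContainsEllOne Y) : ContainsEllOne X := by
  obtain ⟨Z, ⟨e⟩⟩ := h
  exact ⟨Z.map (T : Y →L[ℝ] X).toLinearMap, ⟨e.trans (T.submoduleMap Z)⟩⟩

/-- The functionals of norm at most `1` cannot oscillate across a fixed gap along every subsequence
of a bounded sequence, unless there is a copy of `ℓ₁`: for real numbers `a i` of given signs, two
functionals with opposite oscillations on the independent subsequence `x (m i)` witness the lower
`ℓ₁` estimate of `∑ a i • x (m i)`. -/
lemma not_rich_of_not_containsEllOne [CompleteSpace X] (hX : ¬ ContainsEllOne X) {x : ℕ → X} {C : ℝ}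
    (hb : ∀ n, ‖x n‖ ≤ C) {p q : ℝ} (hpq : p < q) {M : Set ℕ} (hM : M.Infinite) :
    ¬ Rich (fun n => {f : StrongDual ℝ X | f (x n) < p}) (fun n => {f | q < f (x n)})
      {f | ‖f‖ ≤ 1} M := by
  intro hr
  obtain ⟨m, hm⟩ := hr.exists_independent hM
  refine hX (containsEllOne_of_lower_bound (x := fun i => x (m i)) (δ := (q - p) / 2)
    (fun n => hb _) (by linarith) fun a n => ?_)
  obtain ⟨f, hf, hfa⟩ := hm (fun i => decide (a i < 0)) n
  obtain ⟨g, hg, hga⟩ := hm (fun i => decide (0 ≤ a i)) n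
  set y := ∑ i ∈ Finset.range n, a i • x (m i) with hy
  have h1 : (q - p) * ∑ i ∈ Finset.range n, |a i| ≤ f y - g y := by
    rw [hy, map_sum, map_sum, ← Finset.sum_sub_distrib, Finset.mul_sum]
    refine Finset.sum_le_sum fun i hi => ?_
    have h2 := hfa i (Finset.mem_range.1 hi)
    have h3 := hga i (Finset.mem_range.1 hi)
    simp only [map_smul, smul_eq_mul]
    rcases lt_or_ge (a i) 0 with hneg | hpos
    · simp only [hneg, decide_true, if_true, mem_ofPred_eq] at h2
      simp only [not_le.2 hneg, decide_false, Bool.false_eq_true, if_false, mem_ofPred_eq] at h3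
      rw [abs_of_neg hneg]
      nlinarith
    · simp only [not_lt.2 hpos, decide_false, Bool.false_eq_true, if_false, mem_ofPred_eq] at h2
      simp only [hpos, decide_true, if_true, mem_ofPred_eq] at h3
      rw [abs_of_nonneg hpos]
      nlinarith
  have h4 : f y ≤ ‖y‖ := (le_abs_self _).trans (f.le_of_opNorm_le hf y |>.trans (one_mul _).le)
  have h5 : -g y ≤ ‖y‖ := (neg_le_abs _).trans (g.le_of_opNorm_le hg y |>.trans (one_mul _).le)
  linarith

/-- **Rosenthal's `ℓ₁` theorem**: in a Banach space without `ℓ₁`, each bounded sequence has a weakly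
Cauchy subsequence. -/
theorem exists_weaklyCauchy_subseq [CompleteSpace X] (hX : ¬ ContainsEllOne X) {x : ℕ → X} {C : ℝ}
    (hb : ∀ n, ‖x n‖ ≤ C) :
    ∃ m : ℕ → ℕ, StrictMono m ∧
      ∀ f : StrongDual ℝ X, ∃ c, Tendsto (fun n => f (x (m n))) atTop (𝓝 c) := by
  obtain ⟨e, he⟩ := exists_surjective_nat (ℚ × ℚ)
  obtain ⟨m, a, L, hm, ha0, -, hL, hR, hmL⟩ := exists_strictMono_of_step
    (fun (_ : ℕ) _ => True)
    (fun k _ k' L => k' = k + 1 ∧ ((e k).1 < (e k).2 → ∀ f : StrongDual ℝ X, ‖f‖ ≤ 1 →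
      ¬ Straddles (fun n => {f : StrongDual ℝ X | f (x n) < (e k).1})
        (fun n => {f | (e k).2 < f (x n)}) L f))
    (fun k M hM _ => by
      obtain ⟨i, hi⟩ := hM.nonempty
      refine ⟨i, hi, k + 1, ?_⟩
      by_cases hk : (e k).1 < (e k).2
      · have := not_rich_of_not_containsEllOne hX hb (Rat.cast_lt (K := ℝ).2 hk)
          (infinite_inter_Ioi hM i)
        simp only [Rich, not_forall] at this
        obtain ⟨L, hL, hLi, hs⟩ := this
        exact ⟨L, hL.trans inter_subset_left, hLi, fun l hl => (hL hl).2, trivial, rfl,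
          fun _ f hf hst => hs ⟨f, hf, hst⟩⟩
      · exact ⟨M ∩ Ioi i, inter_subset_left, infinite_inter_Ioi hM i, fun l hl => hl.2, trivial,
          rfl, fun h => absurd h hk⟩) (a₀ := 0) infinite_univ trivial
  have ha : ∀ i, a i = i := fun i => by
    induction i with
    | zero => exact ha0
    | succ i ih => rw [(hR i).1, ih]
  have conv : ∀ f : StrongDual ℝ X, ‖f‖ ≤ 1 → ∃ c, Tendsto (fun n => f (x (m n))) atTop (𝓝 c) := by
    intro f hf
    have hbd : ∀ n, |f (x (m n))| ≤ C := fun n =>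
      (f.le_of_opNorm_le hf _).trans ((one_mul _).le.trans (hb _))
    refine tendsto_of_no_upcrossings Rat.denseRange_cast ?_
      (isBoundedUnder_of ⟨C, fun n => (abs_le.1 (hbd n)).2⟩)
      (isBoundedUnder_of ⟨-C, fun n => (abs_le.1 (hbd n)).1⟩)
    rintro _ ⟨p, rfl⟩ _ ⟨q, rfl⟩ hpq ⟨h1, h2⟩
    obtain ⟨k, hk⟩ := he (p, q)
    have inf : ∀ P : ℕ → Prop, (∃ᶠ n in atTop, P (m n)) → {l ∈ L (k + 1) | P l}.Infinite := by
      intro P hP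
      have := (Nat.frequently_atTop_iff_infinite.1
        (hP.and_eventually (eventually_ge_atTop (k + 1)))).image hm.injective.injOn
      refine this.mono ?_
      rintro _ ⟨j, hj, rfl⟩
      exact ⟨hmL _ _ hj.2, hj.1⟩
    have := (hR k).2
    rw [ha, hk] at this
    exact this (Rat.cast_lt.1 hpq) f hf ⟨inf (fun l => f (x l) < p) h1, inf (fun l => q < f (x l)) h2⟩
  refine ⟨m, hm, fun f => ?_⟩
  have hpos : 0 < 1 + ‖f‖ := by positivity
  obtain ⟨c, hc⟩ := conv ((1 + ‖f‖)⁻¹ • f) (by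
    rw [norm_smul, norm_inv, Real.norm_of_nonneg hpos.le, inv_mul_le_iff₀ hpos]
    linarith)
  refine ⟨(1 + ‖f‖) * c, (hc.const_mul (1 + ‖f‖)).congr fun n => ?_⟩
  simp only [smul_apply, smul_eq_mul]
  rw [mul_inv_cancel_left₀ hpos.ne']

end Rosenthal

/-! ### Weakly null and weak* null sequences -/

section

variable {X : Type*} [NormedAddCommGroup X] [NormedSpace ℝ X]

lemma nontrivial_of_not_finiteDimensional (hdim : ¬ FiniteDimensional ℝ X) : Nontrivial X :=
  not_subsingleton_iff_nontrivial.1 fun _ => hdim inferInstance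

lemma limsup_le_iff_of_bdd {a : ℕ → ℝ} {c C : ℝ} (h0 : ∀ n, 0 ≤ a n) (hC : ∀ n, a n ≤ C) :
    limsup a atTop ≤ c ↔ ∀ y > c, ∀ᶠ n in atTop, a n < y :=
  limsup_le_iff (isBoundedUnder_of ⟨0, h0⟩).isCoboundedUnder_le (isBoundedUnder_of ⟨C, hC⟩)

lemma le_liminf_iff_of_bdd {a : ℕ → ℝ} {c C : ℝ} (h0 : ∀ n, 0 ≤ a n) (hC : ∀ n, a n ≤ C) :
    c ≤ liminf a atTop ↔ ∀ y < c, ∀ᶠ n in atTop, y < a n :=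
  le_liminf_iff (isBoundedUnder_of ⟨C, hC⟩).isCoboundedUnder_ge (isBoundedUnder_of ⟨0, h0⟩)

lemma WeaklyNull.exists_norm_le {u : ℕ → X} (hu : WeaklyNull u) : ∃ C, ∀ n, ‖u n‖ ≤ C := by
  obtain ⟨C, hC⟩ := banach_steinhaus
    (g := fun n => NormedSpace.inclusionInDoubleDual ℝ X (u n)) (fun f => by
      obtain ⟨C, hC⟩ := (hu f).norm.bddAbove_range
      exact ⟨C, fun n => by simpa using hC ⟨n, rfl⟩⟩)
  exact ⟨C, fun n => by
    simpa using ((NormedSpace.inclusionInDoubleDualLi ℝ (E := X)).norm_map (u n)).symm.le.trans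
      (hC n)⟩

lemma WeakStarNull.exists_norm_le [CompleteSpace X] {g : ℕ → StrongDual ℝ X}
    (hg : WeakStarNull g) : ∃ C, ∀ n, ‖g n‖ ≤ C :=
  banach_steinhaus fun x => by
    obtain ⟨C, hC⟩ := (hg x).norm.bddAbove_range
    exact ⟨C, fun n => hC ⟨n, rfl⟩⟩

lemma WeaklyNull.smul {u : ℕ → X} (hu : WeaklyNull u) (c : ℝ) : WeaklyNull fun n => c • u n :=
  fun f => by simpa using (hu f).const_mul c

lemma WeakStarNull.smul {g : ℕ → StrongDual ℝ X} (hg : WeakStarNull g) (c : ℝ) :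
    WeakStarNull fun n => c • g n :=
  fun x => by simpa using (hg x).const_mul c

lemma WeaklyNull.comp {u : ℕ → X} (hu : WeaklyNull u) {m : ℕ → ℕ}
    (hm : Tendsto m atTop atTop) : WeaklyNull fun n => u (m n) :=
  fun f => (hu f).comp hm

lemma WeakStarNull.comp {g : ℕ → StrongDual ℝ X} (hg : WeakStarNull g) {m : ℕ → ℕ}
    (hm : Tendsto m atTop atTop) : WeakStarNull fun n => g (m n) :=
  fun x => (hg x).comp hm

/-- A bounded sequence of functionals that tends to `0` on a dense set is weak* null. -/
lemma weakStarNull_of_denseRange {ι : Type*} {d : ι → X} (hd : DenseRange d)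
    {g : ℕ → StrongDual ℝ X} {C : ℝ} (hb : ∀ n, ‖g n‖ ≤ C)
    (h : ∀ k, Tendsto (fun n => g n (d k)) atTop (𝓝 0)) : WeakStarNull g := by
  intro x
  have hC : 0 ≤ C := (norm_nonneg _).trans (hb 0)
  rw [Metric.tendsto_nhds]
  intro ε hε
  obtain ⟨k, hk⟩ := hd.exists_dist_lt x (show 0 < ε / (2 * (C + 1)) by positivity)
  filter_upwards [Metric.tendsto_nhds.1 (h k) (ε / 2) (by positivity)] with n hn
  rw [Real.dist_0_eq_abs] at hn ⊢
  have h1 : |g n (x - d k)| ≤ C * ‖x - d k‖ := (g n).le_of_opNorm_le (hb n) _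
  rw [dist_eq_norm, lt_div_iff₀ (by positivity)] at hk
  have h2 : C * ‖x - d k‖ ≤ ε / 2 := by nlinarith [norm_nonneg (x - d k)]
  have h3 : g n x = g n (x - d k) + g n (d k) := by simp
  rw [h3]
  linarith [abs_add_le (g n (x - d k)) (g n (d k))]

lemma exists_unit_lt_apply {f : StrongDual ℝ X} {r : ℝ} (hr0 : 0 ≤ r) (hr : r < ‖f‖) :
    ∃ x, ‖x‖ = 1 ∧ r < f x := by
  obtain ⟨x, hx1, hx⟩ := f.exists_lt_apply_of_lt_opNorm hr
  have hx0 : 0 < ‖x‖ := by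
    refine norm_pos_iff.2 ?_
    rintro rfl
    simp at hx
    linarith
  have key : ∀ z : X, ‖z‖ = ‖x‖ → r < f z → ∃ x, ‖x‖ = 1 ∧ r < f x := by
    intro z hz hrz
    refine ⟨‖x‖⁻¹ • z, ?_, ?_⟩
    · rw [norm_smul, norm_inv, norm_norm, hz, inv_mul_cancel₀ hx0.ne']
    · rw [map_smul, smul_eq_mul, inv_mul_eq_div, lt_div_iff₀ hx0]
      nlinarith
  rw [Real.norm_eq_abs, lt_abs] at hx
  rcases hx with hx | hx
  · exact key x rfl hx
  · exact key (-x) (norm_neg x) (by simpa using hx)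

/-- The norm of the dual is weak* lower semicontinuous along sequences. -/
lemma WeakStarNull.eventually_lt_norm_add {g : ℕ → StrongDual ℝ X} (hg : WeakStarNull g)
    (f : StrongDual ℝ X) {y : ℝ} (hy : y < ‖f‖) : ∀ᶠ n in atTop, y < ‖f + g n‖ := by
  rcases lt_or_ge y 0 with h0 | h0
  · exact Eventually.of_forall fun n => h0.trans_le (norm_nonneg _)
  obtain ⟨x, hx, hxy⟩ := exists_unit_lt_apply h0 hy
  have ht : Tendsto (fun n => (f + g n) x) atTop (𝓝 (f x + 0)) :=
    (hg x).const_add (f x)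
  filter_upwards [ht.eventually_const_lt (by simpa using hxy)] with n hn
  exact hn.trans_le ((le_abs_self _).trans
    (((f + g n).le_opNorm x).trans (by rw [hx, mul_one])))

/-- The Josefson-Nissenzweig theorem, in the easy case of separable spaces. -/
lemma exists_weakStarNull_norm_eq_one [TopologicalSpace.SeparableSpace X]
    (hdim : ¬ FiniteDimensional ℝ X) :
    ∃ g : ℕ → StrongDual ℝ X, WeakStarNull g ∧ ∀ n, ‖g n‖ = 1 := by
  have : Nonempty X := ⟨0⟩
  have key : ∀ n : ℕ, ∃ g : StrongDual ℝ X, ‖g‖ = 1 ∧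
      ∀ i ≤ n, g (TopologicalSpace.denseSeq X i) = 0 := by
    intro n
    let Z : Submodule ℝ X := Submodule.span ℝ (TopologicalSpace.denseSeq X '' Iic n)
    have hZ : FiniteDimensional ℝ Z := FiniteDimensional.span_of_finite ℝ ((finite_Iic n).image _)
    have hclosed : IsClosed (Z : Set X) := Z.closed_of_finiteDimensional
    have : IsClosed (Z : Set X) := hclosed
    obtain ⟨x, hx⟩ : ∃ x, x ∉ Z := by
      by_contra! hall
      have htop : Z = ⊤ := Submodule.eq_top_iff'.2 hall
      refine hdim ?_
      rw [htop] at hZ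
      exact Module.Finite.equiv (Submodule.topEquiv (R := ℝ) (M := X))
    obtain ⟨f, u, hfu, hux⟩ := geometric_hahn_banach_closed_point Z.convex hclosed hx
    have hf0 : ∀ z ∈ Z, f z = 0 := by
      intro z hz
      by_contra hne
      have := hfu ((u / f z) • z) (Z.smul_mem _ hz)
      rw [map_smul, smul_eq_mul, div_mul_cancel₀ _ hne] at this
      exact lt_irrefl _ this
    have hne : f ≠ 0 := by
      rintro rfl
      have h1 := hfu 0 Z.zero_mem
      simp only [zero_apply] at h1 hux
      linarith
    refine ⟨‖f‖⁻¹ • f, ?_, fun i hi => ?_⟩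
    · rw [norm_smul, norm_inv, norm_norm, inv_mul_cancel₀ (norm_ne_zero_iff.2 hne)]
    · rw [smul_apply, hf0 _ (Submodule.subset_span ⟨i, hi, rfl⟩), smul_zero]
  choose g hg1 hg using key
  refine ⟨g, weakStarNull_of_denseRange (TopologicalSpace.denseRange_denseSeq X)
    (fun n => (hg1 n).le) fun k => ?_, hg1⟩
  refine tendsto_const_nhds.congr' ?_
  filter_upwards [eventually_ge_atTop k] with n hn
  exact (hg n k hn).symm

end

/-! ### The modulus `ρ` -/

section rho

variable {X : Type*} [NormedAddCommGroup X] [NormedSpace ℝ X]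

lemma WeaklyNull.limsup_norm_add_le_iff {u : ℕ → X} (hu : WeaklyNull u) (x : X) {c : ℝ} :
    limsup (fun n => ‖x + u n‖) atTop ≤ c ↔ ∀ y > c, ∀ᶠ n in atTop, ‖x + u n‖ < y := by
  obtain ⟨C, hC⟩ := hu.exists_norm_le
  exact limsup_le_iff_of_bdd (fun n => norm_nonneg _) (C := ‖x‖ + C)
    (fun n => (norm_add_le _ _).trans (by linarith [hC n]))

lemma WeaklyNull.limsup_norm_le_iff {u : ℕ → X} (hu : WeaklyNull u) {c : ℝ} :
    limsup (fun n => ‖u n‖) atTop ≤ c ↔ ∀ y > c, ∀ᶠ n in atTop, ‖u n‖ < y := by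
  simpa using hu.limsup_norm_add_le_iff 0

lemma rho_spec {σ : ℝ} {x : X} (hx : ‖x‖ = 1) {u : ℕ → X} (hu : WeaklyNull u)
    (h : ∀ y > σ, ∀ᶠ n in atTop, ‖u n‖ < y) {y : ℝ} (hy : 1 + rho X σ < y) :
    ∀ᶠ n in atTop, ‖x + u n‖ < y := by
  have hne : {c : ℝ | ∀ (x : X) (u : ℕ → X), ‖x‖ = 1 → WeaklyNull u →
      limsup (fun n => ‖u n‖) atTop ≤ σ → limsup (fun n => ‖x + u n‖) atTop ≤ 1 + c}.Nonempty := by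
    refine ⟨σ, fun x u hx hu h => (hu.limsup_norm_add_le_iff x).2 fun y hy => ?_⟩
    filter_upwards [hu.limsup_norm_le_iff.1 h (y - 1) (by linarith)] with n hn
    linarith [norm_add_le x (u n)]
  obtain ⟨c, hc, hcy⟩ := exists_lt_of_csInf_lt hne (show rho X σ < y - 1 by linarith)
  exact (hu.limsup_norm_add_le_iff x).1 (hc x u hx hu (hu.limsup_norm_le_iff.2 h)) y
    (by linarith)

lemma rho_le_and_nonneg [Nontrivial X] {σ : ℝ} (hσ : 0 ≤ σ) {c : ℝ}
    (H : ∀ (x : X) (u : ℕ → X), ‖x‖ = 1 → WeaklyNull u →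
      (∀ y > σ, ∀ᶠ n in atTop, ‖u n‖ < y) → ∀ y > 1 + c, ∀ᶠ n in atTop, ‖x + u n‖ < y) :
    rho X σ ≤ c ∧ 0 ≤ rho X σ := by
  have lower : ∀ c ∈ {c : ℝ | ∀ (x : X) (u : ℕ → X), ‖x‖ = 1 → WeaklyNull u →
      limsup (fun n => ‖u n‖) atTop ≤ σ → limsup (fun n => ‖x + u n‖) atTop ≤ 1 + c}, 0 ≤ c := by
    intro c hc
    obtain ⟨x, hx⟩ := exists_norm_eq X zero_le_one
    have := hc x (fun _ => 0) hx (fun f => by simp) (by simpa using hσ)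
    simp only [add_zero, limsup_const, hx] at this
    linarith
  have mem : c ∈ {c : ℝ | ∀ (x : X) (u : ℕ → X), ‖x‖ = 1 → WeaklyNull u →
      limsup (fun n => ‖u n‖) atTop ≤ σ → limsup (fun n => ‖x + u n‖) atTop ≤ 1 + c} :=
    fun x u hx hu h => (hu.limsup_norm_add_le_iff x).2 (H x u hx hu (hu.limsup_norm_le_iff.1 h))
  exact ⟨csInf_le ⟨0, lower⟩ mem, le_csInf ⟨c, mem⟩ lower⟩

lemma rho_le [Nontrivial X] {σ : ℝ} (hσ : 0 ≤ σ) {c : ℝ}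
    (H : ∀ (x : X) (u : ℕ → X), ‖x‖ = 1 → WeaklyNull u →
      (∀ y > σ, ∀ᶠ n in atTop, ‖u n‖ < y) → ∀ y > 1 + c, ∀ᶠ n in atTop, ‖x + u n‖ < y) :
    rho X σ ≤ c :=
  (rho_le_and_nonneg hσ H).1

lemma isConvexlikeModulus_rho (X : Type*) [NormedAddCommGroup X] [NormedSpace ℝ X] [Nontrivial X] :
    IsConvexlikeModulus (rho X) where
  map_zero := by
    have := rho_le_and_nonneg (X := X) le_rfl (c := 0) fun x u hx hu h y hy => by
      filter_upwards [h (y - 1) (by linarith)] with n hn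
      linarith [norm_add_le x (u n)]
    exact le_antisymm this.1 this.2
  mono := fun s t hs hst _ => rho_le hs fun x u hx hu h y hy =>
    rho_spec hx hu (fun z hz => h z (hst.trans_lt hz)) hy
  lip := by
    intro s t hs hst ht
    rcases (hs.trans hst).eq_or_lt with h0 | h0
    · have : s = t := le_antisymm hst (h0 ▸ hs)
      simp [this]
    refine rho_le h0.le fun x u hx hu h y hy => ?_
    obtain ⟨k, hk⟩ : ∃ k, k = s / t := ⟨_, rfl⟩
    have hk0 : 0 ≤ k := hk ▸ div_nonneg hs h0.le
    have hk1 : k ≤ 1 := hk ▸ (div_le_one h0).2 hst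
    have hkt : k * t = s := by rw [hk, div_mul_cancel₀ _ h0.ne']
    have hv : ∀ z > s, ∀ᶠ n in atTop, ‖k • u n‖ < z := by
      intro z hz
      filter_upwards [h (t + (z - s) / 2) (by linarith)] with n hn
      rw [norm_smul, Real.norm_of_nonneg hk0]
      have h1 := mul_le_mul_of_nonneg_left hn.le hk0
      have h2 := mul_le_of_le_one_left (show 0 ≤ (z - s) / 2 by linarith) hk1
      linarith
    obtain ⟨ε, hε⟩ : ∃ ε, ε = y - (1 + (rho X s + (t - s))) := ⟨_, rfl⟩
    have hε0 : 0 < ε := by linarith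
    filter_upwards [rho_spec hx (hu.smul k) hv (y := 1 + rho X s + ε / 2) (by linarith),
      h (t + ε / 2) (by linarith)] with n h1 h2
    have h3 : x + u n = (x + k • u n) + (1 - k) • u n := by module
    have h4 := norm_add_le (x + k • u n) ((1 - k) • u n)
    rw [← h3, norm_smul, Real.norm_of_nonneg (sub_nonneg.2 hk1)] at h4
    have h5 := mul_le_mul_of_nonneg_left h2.le (sub_nonneg.2 hk1)
    have h6 := mul_le_of_le_one_left (show 0 ≤ ε / 2 by linarith) (show 1 - k ≤ 1 by linarith)
    linarith
  star := by
    intro s t hs hst ht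
    have h0 : 0 < t := hs.trans_le hst
    rw [← le_div_iff₀' h0]
    refine rho_le hs.le fun x u hx hu h y hy => ?_
    obtain ⟨k, hk⟩ : ∃ k, k = s / t := ⟨_, rfl⟩
    have hk0 : 0 < k := hk ▸ div_pos hs h0
    have hk1 : k ≤ 1 := hk ▸ (div_le_one h0).2 hst
    have hkt : k * t = s := by rw [hk, div_mul_cancel₀ _ h0.ne']
    have hky : s * rho X t / t = k * rho X t := by rw [hk]; ring
    rw [hky] at hy
    have hv : ∀ z > t, ∀ᶠ n in atTop, ‖k⁻¹ • u n‖ < z := by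
      intro z hz
      filter_upwards [h (k * z) (by nlinarith)] with n hn
      rwa [norm_smul, norm_inv, Real.norm_of_nonneg hk0.le, inv_mul_lt_iff₀ hk0]
    filter_upwards [rho_spec hx (hu.smul k⁻¹) hv (y := (y - (1 - k)) / k)
      (by rw [lt_div_iff₀ hk0]; linarith)] with n h1
    have h3 : x + u n = (1 - k) • x + k • (x + k⁻¹ • u n) := by
      rw [smul_add, smul_inv_smul₀ hk0.ne']
      module
    have h4 := norm_add_le ((1 - k) • x) (k • (x + k⁻¹ • u n))
    rw [← h3, norm_smul, norm_smul, Real.norm_of_nonneg (sub_nonneg.2 hk1),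
      Real.norm_of_nonneg hk0.le, hx] at h4
    rw [lt_div_iff₀ hk0] at h1
    linarith

end rho

/-! ### The modulus `θ` -/

section theta

variable {X : Type*} [NormedAddCommGroup X] [NormedSpace ℝ X] [CompleteSpace X]

lemma WeakStarNull.le_liminf_norm_add_iff {g : ℕ → StrongDual ℝ X} (hg : WeakStarNull g)
    (f : StrongDual ℝ X) {c : ℝ} :
    c ≤ liminf (fun n => ‖f + g n‖) atTop ↔ ∀ y < c, ∀ᶠ n in atTop, y < ‖f + g n‖ := by
  obtain ⟨C, hC⟩ := hg.exists_norm_le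
  exact le_liminf_iff_of_bdd (fun n => norm_nonneg _) (C := ‖f‖ + C)
    (fun n => (norm_add_le _ _).trans (by linarith [hC n]))

lemma WeakStarNull.le_liminf_norm_iff {g : ℕ → StrongDual ℝ X} (hg : WeakStarNull g) {c : ℝ} :
    c ≤ liminf (fun n => ‖g n‖) atTop ↔ ∀ y < c, ∀ᶠ n in atTop, y < ‖g n‖ := by
  simpa using hg.le_liminf_norm_add_iff 0

lemma theta_spec {τ : ℝ} {f : StrongDual ℝ X} (hf : ‖f‖ = 1) {g : ℕ → StrongDual ℝ X}
    (hg : WeakStarNull g) (h : ∀ y < τ, ∀ᶠ n in atTop, y < ‖g n‖) {y : ℝ}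
    (hy : y < 1 + theta X τ) : ∀ᶠ n in atTop, y < ‖f + g n‖ := by
  have hne : {c : ℝ | ∀ (f : StrongDual ℝ X) (g : ℕ → StrongDual ℝ X), ‖f‖ = 1 → WeakStarNull g →
      τ ≤ liminf (fun n => ‖g n‖) atTop →
        1 + c ≤ liminf (fun n => ‖f + g n‖) atTop}.Nonempty := by
    refine ⟨0, fun f g hf hg _ => (hg.le_liminf_norm_add_iff f).2 fun y hy => ?_⟩
    exact hg.eventually_lt_norm_add f (by linarith)
  obtain ⟨c, hc, hcy⟩ := exists_lt_of_lt_csSup hne (show y - 1 < theta X τ by linarith)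
  exact (hg.le_liminf_norm_add_iff f).1 (hc f g hf hg (hg.le_liminf_norm_iff.2 h)) y (by linarith)

variable [TopologicalSpace.SeparableSpace X] (hdim : ¬ FiniteDimensional ℝ X)
include hdim

lemma le_theta_and_le {τ : ℝ} (hτ : 0 ≤ τ) {c : ℝ}
    (H : ∀ (f : StrongDual ℝ X) (g : ℕ → StrongDual ℝ X), ‖f‖ = 1 → WeakStarNull g →
      (∀ y < τ, ∀ᶠ n in atTop, y < ‖g n‖) → ∀ y < 1 + c, ∀ᶠ n in atTop, y < ‖f + g n‖) :
    c ≤ theta X τ ∧ theta X τ ≤ τ := by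
  have upper : ∀ c ∈ {c : ℝ | ∀ (f : StrongDual ℝ X) (g : ℕ → StrongDual ℝ X), ‖f‖ = 1 →
      WeakStarNull g → τ ≤ liminf (fun n => ‖g n‖) atTop →
        1 + c ≤ liminf (fun n => ‖f + g n‖) atTop}, c ≤ τ := by
    intro c hc
    obtain ⟨g, hg, hg1⟩ := exists_weakStarNull_norm_eq_one hdim
    have hgτ : ∀ n, ‖τ • g n‖ = τ := fun n => by
      rw [norm_smul, Real.norm_of_nonneg hτ, hg1, mul_one]
    have h1 := hc (g 0) (fun n => τ • g n) (hg1 0) (hg.smul τ) (by simp [hgτ])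
    rw [(hg.smul τ).le_liminf_norm_add_iff] at h1
    refine le_of_forall_lt fun y hy => ?_
    obtain ⟨n, hn⟩ := (h1 (1 + y) (by linarith)).exists
    have := norm_add_le (g 0) (τ • g n)
    rw [hgτ, hg1] at this
    linarith
  have mem : c ∈ {c : ℝ | ∀ (f : StrongDual ℝ X) (g : ℕ → StrongDual ℝ X), ‖f‖ = 1 →
      WeakStarNull g → τ ≤ liminf (fun n => ‖g n‖) atTop →
        1 + c ≤ liminf (fun n => ‖f + g n‖) atTop} :=
    fun f g hf hg h => (hg.le_liminf_norm_add_iff f).2 (H f g hf hg (hg.le_liminf_norm_iff.1 h))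
  exact ⟨le_csSup ⟨τ, upper⟩ mem, csSup_le ⟨c, mem⟩ upper⟩

lemma theta_nonneg_and_le {τ : ℝ} (hτ : 0 ≤ τ) : 0 ≤ theta X τ ∧ theta X τ ≤ τ :=
  le_theta_and_le hdim hτ fun f _ hf hg _ _ hy =>
    hg.eventually_lt_norm_add f (by linarith)

lemma le_theta {τ : ℝ} (hτ : 0 ≤ τ) {c : ℝ}
    (H : ∀ (f : StrongDual ℝ X) (g : ℕ → StrongDual ℝ X), ‖f‖ = 1 → WeakStarNull g →
      (∀ y < τ, ∀ᶠ n in atTop, y < ‖g n‖) → ∀ y < 1 + c, ∀ᶠ n in atTop, y < ‖f + g n‖) :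
    c ≤ theta X τ :=
  (le_theta_and_le hdim hτ H).1

/-- The lower estimate given by `θ`, for functionals of any norm and perturbations that are large
relative to it: by convexity of `t ↦ ‖f + t g‖`, the gain grows at least linearly in the size `ν` of
the perturbation. -/
lemma lt_norm_add_of_theta {f : StrongDual ℝ X} {g : ℕ → StrongDual ℝ X} (hg : WeakStarNull g)
    {σ ν : ℝ} (hσ : 0 < σ) (hν : 0 ≤ ν) (hσν : σ * ‖f‖ ≤ ν)
    (h : ∀ y < ν, ∀ᶠ n in atTop, y < ‖g n‖) {y : ℝ} (hy : y < ‖f‖ + ν * (theta X σ / σ)) :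
    ∀ᶠ n in atTop, y < ‖f + g n‖ := by
  rcases eq_or_ne f 0 with rfl | hf
  · simp only [zero_add, norm_zero] at hy ⊢
    exact h y (hy.trans_le (mul_le_of_le_one_right hν
      ((div_le_one hσ).2 (theta_nonneg_and_le hdim hσ.le).2)))
  have hl : 0 < ‖f‖ := norm_pos_iff.2 hf
  have hν0 : 0 < ν := (mul_pos hσ hl).trans_le hσν
  obtain ⟨l, hl'⟩ : ∃ l, l = ‖f‖ := ⟨_, rfl⟩
  rw [← hl'] at hl hσν hy
  have hunit : ‖l⁻¹ • f‖ = 1 := by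
    rw [norm_smul, norm_inv, Real.norm_of_nonneg hl.le, ← hl', inv_mul_cancel₀ hl.ne']
  obtain ⟨c, hc⟩ : ∃ c, c = σ * l / ν := ⟨_, rfl⟩
  have hc0 : 0 < c := hc ▸ div_pos (mul_pos hσ hl) hν0
  have hc1 : c ≤ 1 := hc ▸ (div_le_one hν0).2 hσν
  have hg' : ∀ y < σ, ∀ᶠ n in atTop, y < ‖(σ / ν) • g n‖ := by
    intro y hy
    filter_upwards [h (y * (ν / σ)) (by
      rw [mul_div_assoc', div_lt_iff₀ hσ]; nlinarith)] with n hn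
    rw [norm_smul, Real.norm_of_nonneg (div_nonneg hσ.le hν)]
    rw [mul_div_assoc', div_lt_iff₀ hσ] at hn
    rw [div_mul_eq_mul_div, lt_div_iff₀ hν0]
    linarith
  filter_upwards [theta_spec hunit (hg.smul (σ / ν)) hg' (y := (c * y + (1 - c) * l) / l) (by
    rw [div_lt_iff₀ hl]
    have : c * y < c * (l + ν * (theta X σ / σ)) := mul_lt_mul_of_pos_left hy hc0
    have h2 : c * (ν * (theta X σ / σ)) = l * theta X σ := by
      rw [hc]; field_simp
    linarith)] with n hn
  have h3 : l • (l⁻¹ • f + (σ / ν) • g n) = (1 - c) • f + c • (f + g n) := by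
    rw [smul_add, smul_inv_smul₀ hl.ne', smul_smul, hc]
    rw [show l * (σ / ν) = σ * l / ν by ring]
    module
  have h4 := norm_add_le ((1 - c) • f) (c • (f + g n))
  rw [← h3, norm_smul, norm_smul, norm_smul, Real.norm_of_nonneg hl.le,
    Real.norm_of_nonneg (sub_nonneg.2 hc1), Real.norm_of_nonneg hc0.le, ← hl'] at h4
  rw [div_lt_iff₀ hl] at hn
  have h5 : c * y < c * ‖f + g n‖ := by linarith
  exact lt_of_mul_lt_mul_left h5 hc0.le

lemma isConvexlikeModulus_theta : IsConvexlikeModulus (theta X) where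
  map_zero := le_antisymm (theta_nonneg_and_le hdim le_rfl).2 (theta_nonneg_and_le hdim le_rfl).1
  mono := fun s t hs hst _ => le_theta hdim (hs.trans hst) fun f g hf hg h y hy =>
    theta_spec hf hg (fun z hz => h z (hz.trans_le hst)) hy
  lip := by
    intro s t hs hst ht
    rcases hs.eq_or_lt with rfl | hs0
    · linarith [(theta_nonneg_and_le hdim hst).2, (theta_nonneg_and_le hdim (le_refl (0 : ℝ))).1]
    have ht0 : 0 < t := hs0.trans_le hst
    rw [← sub_le_iff_le_add]
    refine le_theta hdim hs fun f g hf hg h y hy => ?_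
    -- Enlarge the terms of norm less than `t` to norm `t`.
    let k : ℕ → ℝ := fun n => max 1 (t / ‖g n‖)
    have hk1 : ∀ n, 1 ≤ k n := fun n => le_max_left _ _
    have hks : ∀ᶠ n in atTop, k n ≤ 2 * t / s := by
      filter_upwards [h (s / 2) (by linarith)] with n hn
      refine max_le ?_ ?_
      · rw [le_div_iff₀ hs0]; linarith
      · rw [div_le_div_iff₀ (by linarith) hs0]; nlinarith
    have hw : WeakStarNull fun n => k n • g n := by
      intro x
      have h0 : Tendsto (fun n => 2 * t / s * ‖g n x‖) atTop (𝓝 0) := by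
        simpa using (hg x).norm.const_mul (2 * t / s)
      refine squeeze_zero_norm' ?_ h0
      filter_upwards [hks] with n hn
      rw [smul_apply, norm_smul, Real.norm_of_nonneg (zero_le_one.trans (hk1 n))]
      exact mul_le_mul_of_nonneg_right hn (norm_nonneg _)
    have hkn : ∀ n, 0 < ‖g n‖ → k n * ‖g n‖ = max ‖g n‖ t := fun n hn => by
      rw [max_mul_of_nonneg _ _ hn.le, one_mul, div_mul_cancel₀ _ hn.ne']
    obtain ⟨ε, hε⟩ : ∃ ε, ε = 1 + (theta X t - (t - s)) - y := ⟨_, rfl⟩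
    have hε0 : 0 < ε := by linarith
    have hlarge : ∀ z < t, ∀ᶠ n in atTop, z < ‖k n • g n‖ := by
      intro z hz
      filter_upwards [h (s / 2) (by linarith)] with n hn
      rw [norm_smul, Real.norm_of_nonneg (zero_le_one.trans (hk1 n)), hkn n (by linarith)]
      exact hz.trans_le (le_max_right _ _)
    filter_upwards [theta_spec hf hw hlarge (y := 1 + theta X t - ε / 2) (by linarith),
      h (s / 2) (by linarith), h (s - ε / 2) (by linarith)] with n h1 h2 h3
    have h4 : f + k n • g n = (f + g n) + (k n - 1) • g n := by module
    have h5 := norm_add_le (f + g n) ((k n - 1) • g n)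
    rw [← h4, norm_smul, Real.norm_of_nonneg (sub_nonneg.2 (hk1 n)), sub_mul, one_mul,
      hkn n (by linarith)] at h5
    have h6 : max ‖g n‖ t ≤ ‖g n‖ + (t - s + ε / 2) := max_le (by linarith) (by linarith)
    linarith
  star := by
    intro s t hs hst ht
    have h1 : t * (theta X s / s) ≤ theta X t :=
      le_theta hdim (hs.le.trans hst) fun f g hf hg h y hy =>
        lt_norm_add_of_theta hdim hg hs (hs.le.trans hst) (by rw [hf]; linarith) h (by rwa [hf])
    have h2 : t * theta X s = s * (t * (theta X s / s)) := by field_simp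
    rw [h2]
    exact mul_le_mul_of_nonneg_left h1 hs.le

end theta

/-! ### Duality between `ρ` and `θ` -/

section

variable {X : Type*} [NormedAddCommGroup X] [NormedSpace ℝ X]

lemma exists_norm_le_one_lt_apply {f : StrongDual ℝ X} {r : ℝ} (hr : r < ‖f‖) :
    ∃ x, ‖x‖ ≤ 1 ∧ r < f x := by
  rcases lt_or_ge r 0 with h | h
  · exact ⟨0, by simp, by simpa using h⟩
  · obtain ⟨x, hx, hxr⟩ := exists_unit_lt_apply h hr
    exact ⟨x, hx.le, hxr⟩

/-- In the absence of `ℓ₁`, a weak* null sequence is normed up to a factor `2` by a weakly null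
sequence: norm it by vectors `z n`, pass to a weakly Cauchy subsequence, and use the vectors
`(z (N k) - z k) / 2` with `N k` so large that the `N k`-th functional almost vanishes at `z k`. -/
lemma WeakStarNull.exists_weaklyNull [CompleteSpace X] (hX : ¬ ContainsEllOne X)
    {g : ℕ → StrongDual ℝ X} (hg : WeakStarNull g) {r η : ℝ} (hr : ∀ n, r < ‖g n‖) (hη : 0 < η) :
    ∃ (a : ℕ → ℕ) (u : ℕ → X), Tendsto a atTop atTop ∧ WeaklyNull u ∧ (∀ n, ‖u n‖ ≤ 1) ∧
      ∀ n, (r - η) / 2 ≤ g (a n) (u n) := by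
  choose z hz1 hz using fun n => exists_norm_le_one_lt_apply (hr n)
  obtain ⟨m, hm, hconv⟩ := exists_weaklyCauchy_subseq hX hz1
  have hN : ∀ k, ∃ N, k ≤ N ∧ g (m N) (z (m k)) < η := fun k =>
    ((eventually_ge_atTop k).and
      (((hg (z (m k))).comp hm.tendsto_atTop).eventually_lt_const hη)).exists
  choose N hkN hN using hN
  have hNt : Tendsto N atTop atTop := tendsto_atTop_mono hkN tendsto_id
  refine ⟨fun k => m (N k), fun k => (2⁻¹ : ℝ) • (z (m (N k)) - z (m k)),
    hm.tendsto_atTop.comp hNt, fun f => ?_, fun k => ?_, fun k => ?_⟩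
  · obtain ⟨c, hc⟩ := hconv f
    simpa using ((hc.comp hNt).sub hc).const_mul (2⁻¹ : ℝ)
  · rw [norm_smul, Real.norm_of_nonneg (by norm_num)]
    linarith [norm_sub_le (z (m (N k))) (z (m k)), hz1 (m (N k)), hz1 (m k)]
  · simp only [map_smul, map_sub, smul_eq_mul]
    linarith [hz (m (N k)), hN k]

variable [CompleteSpace X] [TopologicalSpace.SeparableSpace X] (hdim : ¬ FiniteDimensional ℝ X)
include hdim

/-- Test `f + g n` against `x + s • u n`, where `x` norms `f` and the weakly null sequence `u` norms
`g` up to a factor `2`. -/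
lemma one_add_mul_le_rho_theta (hX : ¬ ContainsEllOne X) {s t : ℝ} (hs0 : 0 ≤ s) (hs1 : s ≤ 1)
    (ht0 : 0 ≤ t) (ht1 : t ≤ 1) : 1 + s * t / 2 ≤ (1 + rho X s) * (1 + theta X t) := by
  have := nontrivial_of_not_finiteDimensional hdim
  have hρ := (isConvexlikeModulus_rho X).nonneg hs0 hs1
  obtain ⟨R, hR⟩ : ∃ R, R = 1 + rho X s := ⟨_, rfl⟩
  have hR1 : 1 ≤ R := by linarith
  suffices h : (1 + s * t / 2) / R - 1 ≤ theta X t by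
    rw [← hR, ← div_le_iff₀' (by linarith)]
    linarith
  refine le_theta hdim ht0 fun f g hf hg h y hy => ?_
  by_contra hcon
  rw [add_sub_cancel, lt_div_iff₀ (by linarith)] at hy
  obtain ⟨η, hη⟩ : ∃ η, η = (1 + s * t / 2 - y * R) / 8 := ⟨_, rfl⟩
  have hη0 : 0 < η := by rw [hη]; linarith
  obtain ⟨m, hm, hmy⟩ := extraction_of_frequently_atTop
    ((not_eventually.1 hcon).and_eventually (h (t - η) (by linarith)))
  obtain ⟨a, u, ha, hu, hu1, hgu⟩ := (hg.comp hm.tendsto_atTop).exists_weaklyNull hX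
    (fun n => (hmy n).2) hη0
  have hy0 : 0 ≤ y := (norm_nonneg _).trans (not_lt.1 (hmy 0).1)
  have hy2 : y ≤ 2 := by nlinarith
  obtain ⟨x, hx, hxf⟩ : ∃ x, ‖x‖ = 1 ∧ 1 - η < f x := by
    obtain ⟨x, hx, hxf⟩ := exists_unit_lt_apply (f := f) (le_max_right (1 - η) 0)
      (max_lt (by linarith) (by linarith))
    exact ⟨x, hx, (le_max_left _ _).trans_lt hxf⟩
  have hsu : ∀ z > s, ∀ᶠ n in atTop, ‖s • u n‖ < z := fun z hz =>
    Eventually.of_forall fun n => by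
      rw [norm_smul, Real.norm_of_nonneg hs0]
      exact (mul_le_of_le_one_right hs0 (hu1 n)).trans_lt hz
  obtain ⟨n, h1, h2, h3⟩ := ((rho_spec hx (hu.smul s) hsu (y := R + η) (by linarith)).and
    ((((hu.smul s) f).eventually_const_lt (neg_lt_zero.2 hη0)).and
      (((hg x).comp (hm.tendsto_atTop.comp ha)).eventually_const_lt (neg_lt_zero.2 hη0)))).exists
  simp only [Function.comp_apply] at h3
  have h4 : ‖f + g (m (a n))‖ ≤ y := not_lt.1 (hmy (a n)).1
  have h5 : (f + g (m (a n))) (x + s • u n) ≤ y * (R + η) :=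
    (le_abs_self _).trans (((f + g (m (a n))).le_of_opNorm_le h4 _).trans
      (mul_le_mul_of_nonneg_left h1.le hy0))
  have h6 : (f + g (m (a n))) (x + s • u n) =
      f x + f (s • u n) + g (m (a n)) x + s * g (m (a n)) (u n) := by
    simp only [add_apply, map_add, map_smul, smul_eq_mul]
    ring
  have h7 : s * ((t - η - η) / 2) ≤ s * g (m (a n)) (u n) := mul_le_mul_of_nonneg_left (hgu n) hs0
  have h8 : s * η ≤ η := mul_le_of_le_one_left hη0.le hs1
  have h9 : y * η ≤ 2 * η := mul_le_mul_of_nonneg_right hy2 hη0.le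
  linarith

/-- Norm the vectors `x + u n` by functionals, which converge weak* along a subsequence to some `F`
with differences `g n` of norms tending to `ν`. With `t = θ(σ)/σ`, the upper limit of `‖x + u n‖` is
at most `‖F‖ + ν t`. If `ν < σ`, this is at most `1 + θ(σ)` because `‖F‖ ≤ 1`; if `σ ≤ ν`, it is at
most `1` because `θ` bounds the norms of `F + g n` from below by it. -/
lemma rho_theta_div_le {σ : ℝ} (hσ0 : 0 < σ) :
    rho X (theta X σ / σ) ≤ theta X σ := by
  have := nontrivial_of_not_finiteDimensional hdim
  have hθ := theta_nonneg_and_le hdim hσ0.le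
  obtain ⟨t, ht⟩ : ∃ t, t = theta X σ / σ := ⟨_, rfl⟩
  have ht0 : 0 ≤ t := ht ▸ div_nonneg hθ.1 hσ0.le
  have ht1 : t ≤ 1 := ht ▸ (div_le_one hσ0).2 hθ.2
  have htσ : σ * t = theta X σ := by rw [ht, mul_div_cancel₀ _ hσ0.ne']
  rw [← ht]
  refine rho_le ht0 fun x u hx hu h y hy => ?_
  by_contra hcon
  obtain ⟨m₁, hm₁, hy₁⟩ := extraction_of_frequently_atTop (not_eventually.1 hcon)
  choose Φ hΦ1 hΦ using fun n => exists_dual_vector'' ℝ (x + u (m₁ n))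
  obtain ⟨F, hF, m₂, hm₂, hlim⟩ := WeakDual.isSeqCompact_closedBall ℝ X (0 : StrongDual ℝ X) 1
    (x := fun n => StrongDual.toWeakDual (Φ n)) (fun n => by simpa using hΦ1 n)
  obtain ⟨f, hfF⟩ : ∃ f : StrongDual ℝ X, f = WeakDual.toStrongDual F := ⟨_, rfl⟩
  have hf1 : ‖f‖ ≤ 1 := by
    rw [hfF]
    simpa using hF
  have hg₂ : WeakStarNull fun n => Φ (m₂ n) - f := by
    intro z
    have := (((WeakDual.eval_continuous z).tendsto _).comp hlim).sub_const (f z)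
    rw [show F z = f z by rw [hfF]; rfl, sub_self] at this
    exact this
  obtain ⟨ν, hν, m₃, hm₃, hνlim⟩ := (isCompact_Icc (a := (0 : ℝ)) (b := 2)).tendsto_subseq
    (x := fun n => ‖Φ (m₂ n) - f‖) fun n =>
      ⟨norm_nonneg _, (norm_sub_le _ _).trans (by linarith [hΦ1 (m₂ n)])⟩
  have hg := hg₂.comp hm₃.tendsto_atTop
  have hm : Tendsto (fun n => m₁ (m₂ (m₃ n))) atTop atTop :=
    hm₁.tendsto_atTop.comp (hm₂.tendsto_atTop.comp hm₃.tendsto_atTop)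
  have hbound : ‖f‖ + ν * t ≤ 1 + theta X σ := by
    rcases lt_or_ge ν σ with hlt | hge
    · have := mul_le_mul_of_nonneg_right hlt.le ht0
      linarith
    · by_contra hgt
      obtain ⟨n, hn⟩ := (lt_norm_add_of_theta hdim hg hσ0 hν.1
        ((mul_le_of_le_one_right hσ0.le hf1).trans hge)
        (fun z hz => hνlim.eventually_const_lt hz) (y := 1) (by rw [← ht]; linarith)).exists
      rw [add_sub_cancel] at hn
      linarith [hΦ1 (m₂ (m₃ n))]
  obtain ⟨G, hG⟩ : ∃ G, G = y - (1 + theta X σ) := ⟨_, rfl⟩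
  have hG0 : 0 < G := by linarith
  obtain ⟨δ, hδ0, hδ1, hδG⟩ : ∃ δ > 0, δ ≤ 1 ∧ δ ≤ G / 16 :=
    ⟨min 1 (G / 16), lt_min one_pos (by linarith), min_le_left _ _, min_le_right _ _⟩
  obtain ⟨n, ⟨h1, h2⟩, h3, h4⟩ := (((hνlim.eventually_lt_const
    (show ν < ν + δ by linarith)).and (hm.eventually (h (t + δ) (by linarith)))).and
    ((((hu f).comp hm).eventually_lt_const (show 0 < G / 4 by linarith)).and
      ((hg x).eventually_lt_const (show 0 < G / 4 by linarith)))).exists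
  simp only [Function.comp_apply] at h1 h3
  have h5 : y ≤ Φ (m₂ (m₃ n)) (x + u (m₁ (m₂ (m₃ n)))) := by
    rw [hΦ]
    exact not_lt.1 (hy₁ _)
  set v := u (m₁ (m₂ (m₃ n)))
  set g := Φ (m₂ (m₃ n)) - f with hgdef
  have h6 : Φ (m₂ (m₃ n)) (x + v) = f x + f v + g x + g v := by
    rw [hgdef]
    simp only [map_add, sub_apply]
    ring
  have h7 : f x ≤ ‖f‖ := by
    have := (le_abs_self _).trans (f.le_opNorm x)
    rwa [hx, mul_one] at this
  have h8 : g v ≤ (ν + δ) * (t + δ) :=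
    (le_abs_self _).trans ((g.le_of_opNorm_le h1.le v).trans
      (mul_le_mul_of_nonneg_left h2.le (by linarith [hν.1])))
  have h9 : (ν + δ) * (t + δ) ≤ ν * t + 4 * δ := by nlinarith [hν.2]
  linarith

theorem dualModuli_rho_theta (hX : ¬ ContainsEllOne X) : DualModuli (rho X) (theta X) where
  left :=
    have := nontrivial_of_not_finiteDimensional hdim
    isConvexlikeModulus_rho X
  right := isConvexlikeModulus_theta hdim
  mul_ge := fun _ _ h0 h1 h2 h3 => one_add_mul_le_rho_theta hdim hX h0 h1 h2 h3
  apply_div_le := fun _ h0 _ => rho_theta_div_le hdim h0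

end

/-! ### The moduli `φ` and `ψ` -/

/-- The relation between dual moduli survives passing to the infimum of the first components and
the supremum of the second ones. -/
lemma DualModuli.of_isGLB_of_isLUB {𝒬 : Set ((ℝ → ℝ) × (ℝ → ℝ))}
    (H : ∀ p ∈ 𝒬, DualModuli p.1 p.2) (hne : 𝒬.Nonempty) {r h : ℝ → ℝ}
    (hr : ∀ s, 0 ≤ s → s ≤ 1 → IsGLB ((fun p => p.1 s) '' 𝒬) (r s))
    (hh : ∀ t, 0 ≤ t → t ≤ 1 → IsLUB ((fun p => p.2 t) '' 𝒬) (h t)) : DualModuli r h := by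
  have r_le : ∀ p ∈ 𝒬, ∀ s, 0 ≤ s → s ≤ 1 → r s ≤ p.1 s :=
    fun p hp s h0 h1 => (hr s h0 h1).1 ⟨p, hp, rfl⟩
  have le_h : ∀ p ∈ 𝒬, ∀ t, 0 ≤ t → t ≤ 1 → p.2 t ≤ h t :=
    fun p hp t h0 h1 => (hh t h0 h1).1 ⟨p, hp, rfl⟩
  have le_r : ∀ s c, 0 ≤ s → s ≤ 1 → (∀ p ∈ 𝒬, c ≤ p.1 s) → c ≤ r s := by
    intro s c h0 h1 hc
    refine (hr s h0 h1).2 ?_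
    rintro _ ⟨p, hp, rfl⟩
    exact hc p hp
  have h_le : ∀ t c, 0 ≤ t → t ≤ 1 → (∀ p ∈ 𝒬, p.2 t ≤ c) → h t ≤ c := by
    intro t c h0 h1 hc
    refine (hh t h0 h1).2 ?_
    rintro _ ⟨p, hp, rfl⟩
    exact hc p hp
  obtain ⟨p₀, hp₀⟩ := hne
  have left : IsConvexlikeModulus r :=
    { map_zero := le_antisymm
        ((r_le p₀ hp₀ 0 le_rfl zero_le_one).trans (H p₀ hp₀).left.map_zero.le)
        (le_r 0 0 le_rfl zero_le_one fun p hp => (H p hp).left.map_zero.ge)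
      mono := fun s t hs hst ht => le_r _ _ (hs.trans hst) ht fun p hp =>
        (r_le p hp s hs (hst.trans ht)).trans ((H p hp).left.mono hs hst ht)
      lip := fun s t hs hst ht => sub_le_iff_le_add.1 <|
        le_r _ _ hs (hst.trans ht) fun p hp => sub_le_iff_le_add.2 <|
          (r_le p hp t (hs.trans hst) ht).trans ((H p hp).left.lip hs hst ht)
      star := fun s t hs hst ht => (div_le_iff₀' hs).1 <|
        le_r _ _ (hs.le.trans hst) ht fun p hp => (div_le_iff₀' hs).2 <|
          (mul_le_mul_of_nonneg_left (r_le p hp s hs.le (hst.trans ht)) (hs.le.trans hst)).trans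
            ((H p hp).left.star hs hst ht) }
  have right : IsConvexlikeModulus h :=
    { map_zero := le_antisymm
        (h_le 0 0 le_rfl zero_le_one fun p hp => (H p hp).right.map_zero.le)
        ((H p₀ hp₀).right.map_zero.ge.trans (le_h p₀ hp₀ 0 le_rfl zero_le_one))
      mono := fun s t hs hst ht => h_le _ _ hs (hst.trans ht) fun p hp =>
        ((H p hp).right.mono hs hst ht).trans (le_h p hp t (hs.trans hst) ht)
      lip := fun s t hs hst ht => h_le _ _ (hs.trans hst) ht fun p hp =>
        ((H p hp).right.lip hs hst ht).trans (by linarith [le_h p hp s hs (hst.trans ht)])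
      star := fun s t hs hst ht => (le_div_iff₀' (hs.trans_le hst)).1 <|
        h_le _ _ hs.le (hst.trans ht) fun p hp => (le_div_iff₀' (hs.trans_le hst)).2 <|
          ((H p hp).right.star hs hst ht).trans
            (mul_le_mul_of_nonneg_left (le_h p hp t (hs.le.trans hst) ht) hs.le) }
  refine ⟨left, right, fun s t hs0 hs1 ht0 ht1 => ?_, fun t ht0 ht1 => ?_⟩
  · have hpos : 0 < 1 + h t := by linarith [right.nonneg ht0 ht1]
    rw [← div_le_iff₀ hpos, ← sub_le_iff_le_add']
    refine le_r _ _ hs0 hs1 fun p hp => ?_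
    rw [sub_le_iff_le_add', div_le_iff₀ hpos]
    exact ((H p hp).mul_ge hs0 hs1 ht0 ht1).trans (mul_le_mul_of_nonneg_left
      (by linarith [le_h p hp t ht0 ht1]) (by linarith [(H p hp).left.nonneg hs0 hs1]))
  · refine le_of_forall_pos_le_add fun ε hε => ?_
    obtain ⟨_, ⟨p, hp, rfl⟩, hlt, hle⟩ :=
      (hh t ht0.le ht1).exists_between (show h t - ε * t < h t by nlinarith)
    have h1 := (H p hp).right.nonneg ht0.le ht1
    have h2 : h t / t ≤ 1 := (div_le_one ht0).2 (right.le_self ht0.le ht1)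
    have h3 : p.2 t / t ≤ h t / t := div_le_div_of_nonneg_right hle ht0.le
    have h4 := left.lip (div_nonneg h1 ht0.le) h3 h2
    have h5 := r_le p hp _ (div_nonneg h1 ht0.le) (h3.trans h2)
    have h6 := (H p hp).apply_div_le ht0 ht1
    have h7 : h t / t - p.2 t / t ≤ ε := by
      rw [← sub_div, div_le_iff₀ ht0]
      simp only at hlt
      linarith
    linarith

universe u

/-- The infimum in the Banach-Mazur distance need not be attained, whence the `ε`. -/
lemma exists_equiv_of_banachMazurDist_le {X Y : Type u} [NormedAddCommGroup X] [NormedSpace ℝ X]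
    [Nontrivial X] [NormedAddCommGroup Y] [NormedSpace ℝ Y] (h : banachMazurDist X Y ≤ 2) {ε : ℝ}
    (hε : 0 < ε) :
    ∃ T : X ≃L[ℝ] Y, ‖(T : X →L[ℝ] Y)‖ ≤ 2 + ε ∧ ‖(T.symm : Y →L[ℝ] X)‖ ≤ 1 := by
  have h2 : (2 : ℝ≥0∞) < ENNReal.ofReal (2 + ε) := by
    rw [← ENNReal.ofReal_ofNat, ENNReal.ofReal_lt_ofReal_iff] <;> linarith
  obtain ⟨T, hT⟩ := iInf_lt_iff.1 (h.trans_lt h2)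
  have hT' : ‖(T : X →L[ℝ] Y)‖ * ‖(T.symm : Y →L[ℝ] X)‖ < 2 + ε :=
    (ENNReal.ofReal_lt_ofReal_iff (by linarith)).1 hT
  have hpos : 0 < ‖(T.symm : Y →L[ℝ] X)‖ := T.norm_symm_pos
  let S : X ≃L[ℝ] Y := T.trans
    (ContinuousLinearEquiv.smulLeft (Units.mk0 ‖(T.symm : Y →L[ℝ] X)‖ hpos.ne'))
  refine ⟨S, ?_, ?_⟩
  · refine ContinuousLinearMap.opNorm_le_bound _ (by linarith) fun x => ?_
    have : S x = ‖(T.symm : Y →L[ℝ] X)‖ • T x := rfl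
    rw [ContinuousLinearEquiv.coe_coe, this, norm_smul, norm_norm]
    have h3 := (T : X →L[ℝ] Y).le_opNorm x
    have := mul_le_mul_of_nonneg_right hT'.le (norm_nonneg x)
    rw [ContinuousLinearEquiv.coe_coe] at h3
    nlinarith
  · refine ContinuousLinearMap.opNorm_le_bound _ zero_le_one fun y => ?_
    have : S.symm y = ‖(T.symm : Y →L[ℝ] X)‖⁻¹ • T.symm y := by
      rw [S.symm_apply_eq]
      change y = ‖(T.symm : Y →L[ℝ] X)‖ • T (‖(T.symm : Y →L[ℝ] X)‖⁻¹ • T.symm y)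
      rw [map_smul, smul_inv_smul₀ hpos.ne', T.apply_symm_apply]
    rw [ContinuousLinearEquiv.coe_coe, this, norm_smul, norm_inv, norm_norm, inv_mul_le_iff₀ hpos,
      one_mul]
    exact (T.symm : Y →L[ℝ] X).le_opNorm y

/-- Isomorphic copies of a separable infinite-dimensional Banach space without `ℓ₁` are spaces of the
same kind. -/
lemma properties_of_equiv {X Y : Type*} [NormedAddCommGroup X] [NormedSpace ℝ X]
    [TopologicalSpace.SeparableSpace X] [NormedAddCommGroup Y] [NormedSpace ℝ Y] (T : X ≃L[ℝ] Y)
    (hdim : ¬ FiniteDimensional ℝ X) (hX : ¬ ContainsEllOne X) :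
    TopologicalSpace.SeparableSpace Y ∧ ¬ FiniteDimensional ℝ Y ∧ ¬ ContainsEllOne Y :=
  ⟨T.surjective.denseRange.separableSpace T.continuous,
    fun _ => hdim (Module.Finite.equiv T.symm.toLinearEquiv), fun h => hX (h.of_equiv T.symm)⟩

section

variable {X : Type u} [NormedAddCommGroup X] [NormedSpace ℝ X] [CompleteSpace X]
  [TopologicalSpace.SeparableSpace X] (hdim : ¬ FiniteDimensional ℝ X) (hX : ¬ ContainsEllOne X)

lemma banachMazurDist_self_le (X : Type u) [NormedAddCommGroup X] [NormedSpace ℝ X] :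
    banachMazurDist X X ≤ 2 := by
  refine (iInf_le _ (ContinuousLinearEquiv.refl ℝ X)).trans ?_
  rw [← ENNReal.ofReal_ofNat]
  refine ENNReal.ofReal_le_ofReal ?_
  have h : ‖(ContinuousLinearEquiv.refl ℝ X : X →L[ℝ] X)‖ ≤ 1 := ContinuousLinearMap.norm_id_le
  have : ‖((ContinuousLinearEquiv.refl ℝ X).symm : X →L[ℝ] X)‖ ≤ 1 :=
    ContinuousLinearMap.norm_id_le
  nlinarith [norm_nonneg (ContinuousLinearEquiv.refl ℝ X : X →L[ℝ] X)]

include hdim hX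

theorem isLUB_psi {τ : ℝ} (h0 : 0 ≤ τ) :
    IsLUB {r : ℝ | ∃ (Y : Type u) (_ : NormedAddCommGroup Y) (_ : NormedSpace ℝ Y)
      (_ : CompleteSpace Y), banachMazurDist X Y ≤ 2 ∧ r = theta Y τ} (psi X τ) := by
  have := nontrivial_of_not_finiteDimensional hdim
  refine isLUB_csSup ⟨_, X, _, _, ‹_›, banachMazurDist_self_le X, rfl⟩ ⟨τ, ?_⟩
  rintro _ ⟨Y, _, _, _, hY, rfl⟩
  obtain ⟨T, -⟩ := exists_equiv_of_banachMazurDist_le hY one_pos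
  obtain ⟨_, hdimY, -⟩ := properties_of_equiv T hdim hX
  exact (theta_nonneg_and_le hdimY h0).2

theorem dualModuli_phi_psi : DualModuli (phi X) (psi X) := by
  have := nontrivial_of_not_finiteDimensional hdim
  let 𝒬 : Set ((ℝ → ℝ) × (ℝ → ℝ)) :=
    {p | ∃ (Y : Type u) (_ : NormedAddCommGroup Y) (_ : NormedSpace ℝ Y)
      (_ : CompleteSpace Y), banachMazurDist X Y ≤ 2 ∧ p = (rho Y, theta Y)}
  have H : ∀ p ∈ 𝒬, DualModuli p.1 p.2 := by
    rintro _ ⟨Y, _, _, _, hY, rfl⟩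
    obtain ⟨T, -⟩ := exists_equiv_of_banachMazurDist_le hY one_pos
    obtain ⟨_, hdimY, hY1⟩ := properties_of_equiv T hdim hX
    exact dualModuli_rho_theta hdimY hY1
  have hne : 𝒬.Nonempty := ⟨_, X, _, _, ‹_›, banachMazurDist_self_le X, rfl⟩
  refine DualModuli.of_isGLB_of_isLUB H hne (fun s h0 h1 => ?_) (fun t h0 h1 => ?_)
  · have heq : (fun p : (ℝ → ℝ) × (ℝ → ℝ) => p.1 s) '' 𝒬 =
        {r : ℝ | ∃ (Y : Type u) (_ : NormedAddCommGroup Y) (_ : NormedSpace ℝ Y)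
          (_ : CompleteSpace Y), banachMazurDist X Y ≤ 2 ∧ r = rho Y s} := by
      ext r
      constructor
      · rintro ⟨_, ⟨Y, i1, i2, i3, hY, rfl⟩, rfl⟩
        exact ⟨Y, i1, i2, i3, hY, rfl⟩
      · rintro ⟨Y, i1, i2, i3, hY, rfl⟩
        exact ⟨_, ⟨Y, i1, i2, i3, hY, rfl⟩, rfl⟩
    rw [phi, ← heq]
    refine isGLB_csInf (hne.image _) ⟨0, ?_⟩
    rintro _ ⟨p, hp, rfl⟩
    exact (H p hp).left.nonneg h0 h1
  · convert isLUB_psi hdim hX h0 using 1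
    ext r
    constructor
    · rintro ⟨_, ⟨Y, i1, i2, i3, hY, rfl⟩, rfl⟩
      exact ⟨Y, i1, i2, i3, hY, rfl⟩
    · rintro ⟨Y, i1, i2, i3, hY, rfl⟩
      exact ⟨_, ⟨Y, i1, i2, i3, hY, rfl⟩, rfl⟩

end

/-! ### The convex Szlenk index -/

section

variable {X Y : Type*} [NormedAddCommGroup X] [NormedSpace ℝ X]
  [NormedAddCommGroup Y] [NormedSpace ℝ Y]

/-- The dual ball of radius `r` of `X` for the norm transported from `Y` along `T`. -/
def transportedBall (T : X ≃L[ℝ] Y) (r : ℝ) : Set (WeakDual ℝ X) :=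
  {f | ‖(WeakDual.toStrongDual f).comp (T.symm : Y →L[ℝ] X)‖ ≤ r}

lemma convex_transportedBall (T : X ≃L[ℝ] Y) (r : ℝ) : Convex ℝ (transportedBall T r) := by
  intro f hf g hg a b ha hb hab
  have h1 : (WeakDual.toStrongDual (a • f + b • g)).comp (T.symm : Y →L[ℝ] X) =
      a • (WeakDual.toStrongDual f).comp (T.symm : Y →L[ℝ] X) +
        b • (WeakDual.toStrongDual g).comp (T.symm : Y →L[ℝ] X) := rfl
  have hf : ‖(WeakDual.toStrongDual f).comp (T.symm : Y →L[ℝ] X)‖ ≤ r := hf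
  have hg : ‖(WeakDual.toStrongDual g).comp (T.symm : Y →L[ℝ] X)‖ ≤ r := hg
  change ‖_‖ ≤ r
  rw [h1]
  have h2 := norm_add_le (a • (WeakDual.toStrongDual f).comp (T.symm : Y →L[ℝ] X))
    (b • (WeakDual.toStrongDual g).comp (T.symm : Y →L[ℝ] X))
  rw [norm_smul, norm_smul, Real.norm_of_nonneg ha, Real.norm_of_nonneg hb] at h2
  have h3 := mul_le_mul_of_nonneg_left hf ha
  have h4 := mul_le_mul_of_nonneg_left hg hb
  have h5 : a * r + b * r = r := by rw [← add_mul, hab, one_mul]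
  linarith

lemma isClosed_transportedBall (T : X ≃L[ℝ] Y) (r : ℝ) : IsClosed (transportedBall T r) := by
  rcases lt_or_ge r 0 with h | h
  · convert isClosed_empty
    exact eq_empty_of_forall_notMem fun f hf => (h.trans_le (norm_nonneg _)).not_ge hf
  · have : transportedBall T r = ⋂ y : Y, {f : WeakDual ℝ X | ‖f (T.symm y)‖ ≤ r * ‖y‖} := by
      ext f
      rw [mem_iInter]
      exact ContinuousLinearMap.opNorm_le_iff h
    rw [this]
    exact isClosed_iInter fun y =>
      isClosed_le (WeakDual.eval_continuous (T.symm y)).norm continuous_const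

/-- In separable spaces, the points of the Szlenk derivation of a bounded set are weak* limits of
sequences in the set that stay away from them in norm. -/
lemma exists_seq_of_mem_szlenkDerivation [TopologicalSpace.SeparableSpace X] {t C : ℝ}
    {K : Set (WeakDual ℝ X)} (hK : ∀ f ∈ K, ‖WeakDual.toStrongDual f‖ ≤ C) {f : WeakDual ℝ X}
    (hf : f ∈ szlenkDerivation t K) :
    ∃ h : ℕ → WeakDual ℝ X, (∀ n, h n ∈ K) ∧
      WeakStarNull (fun n => WeakDual.toStrongDual (h n) - WeakDual.toStrongDual f) ∧
      ∀ n, t / 2 < ‖WeakDual.toStrongDual (h n) - WeakDual.toStrongDual f‖ := by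
  have : Nonempty X := ⟨0⟩
  have key : ∀ n : ℕ, ∃ h ∈ K,
      (∀ i < n, |h (TopologicalSpace.denseSeq X i) - f (TopologicalSpace.denseSeq X i)| <
        1 / ((n : ℝ) + 1)) ∧
      t / 2 < ‖WeakDual.toStrongDual h - WeakDual.toStrongDual f‖ := by
    intro n
    let V : Set (WeakDual ℝ X) := ⋂ i ∈ Finset.range n, {h |
      |h (TopologicalSpace.denseSeq X i) - f (TopologicalSpace.denseSeq X i)| < 1 / ((n : ℝ) + 1)}
    have hV : IsOpen V := isOpen_biInter_finset fun i _ =>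
      isOpen_lt ((WeakDual.eval_continuous _).sub continuous_const).abs continuous_const
    have hfV : f ∈ V := mem_iInter₂.2 fun i _ => by
      simp only [mem_ofPred_eq, sub_self, abs_zero]
      positivity
    by_contra! hcon
    refine hf.2 ⟨V, ⟨hV, Metric.ediam_le_of_forall_dist_le ?_⟩, hfV⟩
    have half : ∀ h ∈ V ∩ K, ‖WeakDual.toStrongDual h - WeakDual.toStrongDual f‖ ≤ t / 2 :=
      fun h hh => hcon h hh.2 fun i hi => mem_iInter₂.1 hh.1 i (Finset.mem_range.2 hi)
    rintro _ ⟨a, ha, rfl⟩ _ ⟨b, hb, rfl⟩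
    rw [dist_eq_norm, ← sub_sub_sub_cancel_right _ _ (WeakDual.toStrongDual f)]
    linarith [norm_sub_le (WeakDual.toStrongDual a - WeakDual.toStrongDual f)
      (WeakDual.toStrongDual b - WeakDual.toStrongDual f), half a ha, half b hb]
  choose h hhK hhd hht using key
  refine ⟨h, hhK, weakStarNull_of_denseRange (TopologicalSpace.denseRange_denseSeq X)
    (C := C + C) (fun n => ?_) fun k => ?_, hht⟩
  · exact (norm_sub_le _ _).trans (add_le_add (hK _ (hhK n)) (hK f hf.1))
  · refine squeeze_zero_norm' ?_ (tendsto_one_div_add_atTop_nhds_zero_nat (𝕜 := ℝ))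
    filter_upwards [eventually_gt_atTop k] with n hn
    exact (hhd n k hn).le

variable [TopologicalSpace.SeparableSpace X] [CompleteSpace Y]
  [TopologicalSpace.SeparableSpace Y] (hdimY : ¬ FiniteDimensional ℝ Y)
include hdimY

/-- A convex derivation shrinks the radius, in the norm transported from `Y`, by a fixed value of
`θ_Y`. -/
lemma convexSzlenkDerivation_subset (T : X ≃L[ℝ] Y) {D t r : ℝ} (ht : 0 < t) (hr : r ≤ 1)
    (hD0 : 0 < D) (hD : ‖(T : X →L[ℝ] Y)‖ ≤ D)
    {K : Set (WeakDual ℝ X)} (hK : K ⊆ transportedBall T r) :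
    convexSzlenkDerivation t K ⊆ transportedBall T (r - theta Y (t / (2 * D))) := by
  refine closure_minimal (convexHull_min ?_ (convex_transportedBall T _))
    (isClosed_transportedBall T _)
  intro f hf
  have hnorm : ∀ g : StrongDual ℝ X, ‖g‖ ≤ ‖g.comp (T.symm : Y →L[ℝ] X)‖ * D := by
    intro g
    have h1 : g = (g.comp (T.symm : Y →L[ℝ] X)).comp (T : X →L[ℝ] Y) := by
      ext x
      simp
    calc ‖g‖ = ‖(g.comp (T.symm : Y →L[ℝ] X)).comp (T : X →L[ℝ] Y)‖ := by rw [← h1]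
      _ ≤ _ := (ContinuousLinearMap.opNorm_comp_le _ _).trans
        (mul_le_mul_of_nonneg_left hD (norm_nonneg _))
  obtain ⟨h, hhK, hnull, hfar⟩ := exists_seq_of_mem_szlenkDerivation (C := r * D)
    (fun g hg => (hnorm _).trans (mul_le_mul_of_nonneg_right (hK hg) hD0.le)) hf
  obtain ⟨σ, hσ⟩ : ∃ σ, σ = t / (2 * D) := ⟨_, rfl⟩
  have hσ0 : 0 < σ := hσ ▸ by positivity
  rw [← hσ]
  set F : StrongDual ℝ Y := (WeakDual.toStrongDual f).comp (T.symm : Y →L[ℝ] X) with hF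
  have hFr : ‖F‖ ≤ r := hK hf.1
  let G : ℕ → StrongDual ℝ Y := fun n =>
    (WeakDual.toStrongDual (h n) - WeakDual.toStrongDual f).comp (T.symm : Y →L[ℝ] X)
  have hG : WeakStarNull G := fun y => hnull (T.symm y)
  have hGσ : ∀ n, σ < ‖G n‖ := fun n => by
    rw [hσ, div_lt_iff₀ (by positivity)]
    have h1 := (hfar n).trans_le (hnorm _)
    change _ < ‖G n‖ * D at h1
    linarith
  change ‖F‖ ≤ r - theta Y σ
  rw [le_sub_iff_add_le]
  refine le_of_forall_lt fun y hy => ?_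
  obtain ⟨n, hn⟩ := (lt_norm_add_of_theta hdimY hG (f := F) hσ0 hσ0.le
    (mul_le_of_le_one_right hσ0.le (hFr.trans hr))
    (fun z hz => Eventually.of_forall fun n => hz.trans (hGσ n))
    (by rwa [mul_div_cancel₀ _ hσ0.ne'])).exists
  refine hn.trans_le ?_
  have h2 : F + G n = (WeakDual.toStrongDual (h n)).comp (T.symm : Y →L[ℝ] X) := by
    ext y
    simp [F, G]
  rw [h2]
  exact hK (hhK n)

lemma Cz_le_of_one_lt_mul_theta (T : X ≃L[ℝ] Y) {D t : ℝ} (ht : 0 < t) (hD0 : 0 < D)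
    (hD : ‖(T : X →L[ℝ] Y)‖ ≤ D) (hT : ‖(T.symm : Y →L[ℝ] X)‖ ≤ 1) {N : ℕ}
    (hN : 1 < N * theta Y (t / (2 * D))) : Cz X t ≤ N := by
  have hθ := (theta_nonneg_and_le hdimY (show 0 ≤ t / (2 * D) by positivity)).1
  have iter : ∀ n : ℕ, (convexSzlenkDerivation t)^[n]
      (WeakDual.toStrongDual ⁻¹' Metric.closedBall (0 : StrongDual ℝ X) 1) ⊆
        transportedBall T (1 - n * theta Y (t / (2 * D))) := by
    intro n
    induction n with
    | zero =>
      intro f hf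
      have hf1 : ‖WeakDual.toStrongDual f‖ ≤ 1 := by simpa using hf
      change ‖_‖ ≤ _
      refine (ContinuousLinearMap.opNorm_comp_le _ _).trans ?_
      simpa using mul_le_one₀ hf1 (norm_nonneg _) hT
    | succ n ih =>
      rw [Function.iterate_succ_apply']
      have h1 : (0 : ℝ) ≤ n * theta Y (t / (2 * D)) := mul_nonneg n.cast_nonneg hθ
      refine (convexSzlenkDerivation_subset hdimY T ht (by linarith) hD0 hD ih).trans
        (Eq.subset ?_)
      congr 1
      push_cast
      ring
  refine iInf₂_le N (eq_empty_of_forall_notMem fun f hf => ?_)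
  have h1 := iter N hf
  have h2 : ‖_‖ ≤ _ := h1
  linarith [(norm_nonneg _).trans h2]

end

section

variable {X : Type u} [NormedAddCommGroup X] [NormedSpace ℝ X] [CompleteSpace X]
  [TopologicalSpace.SeparableSpace X] (hdim : ¬ FiniteDimensional ℝ X) (hX : ¬ ContainsEllOne X)
include hdim hX

theorem Cz_le_one_add_inv_psi {t : ℝ} (ht0 : 0 < t) (ht1 : t ≤ 1) :
    (Cz X t : ℝ≥0∞) ≤ 1 + 1 / ENNReal.ofReal (psi X (t / 4)) := by
  have := nontrivial_of_not_finiteDimensional hdim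
  rcases le_or_gt (psi X (t / 4)) 0 with hp | hp
  · simp [ENNReal.ofReal_of_nonpos hp]
  obtain ⟨N, hN⟩ : ∃ N : ℕ, N = ⌊1 / psi X (t / 4)⌋₊ + 1 := ⟨_, rfl⟩
  have hN1 : 1 / psi X (t / 4) < N := by
    rw [hN]
    exact_mod_cast Nat.lt_floor_add_one _
  have hN2 : (N : ℝ) ≤ 1 + 1 / psi X (t / 4) := by
    rw [hN]
    push_cast
    linarith [Nat.floor_le (one_div_nonneg.2 hp.le)]
  have hN0 : (0 : ℝ) < N := (one_div_pos.2 hp).trans hN1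
  suffices h : Cz X t ≤ N by
    calc (Cz X t : ℝ≥0∞) ≤ ((N : ℕ∞) : ℝ≥0∞) := by exact_mod_cast h
      _ = ENNReal.ofReal N := by simp
      _ ≤ ENNReal.ofReal (1 + 1 / psi X (t / 4)) := ENNReal.ofReal_le_ofReal hN2
      _ = 1 + 1 / ENNReal.ofReal (psi X (t / 4)) := by
        rw [ENNReal.ofReal_add zero_le_one (one_div_nonneg.2 hp.le), ENNReal.ofReal_one,
          ENNReal.ofReal_div_of_pos hp, ENNReal.ofReal_one]
  have ht4 : 0 < t / 4 := by linarith
  obtain ⟨_, ⟨Y, _, _, _, hY, rfl⟩, hlt, -⟩ := (isLUB_psi hdim hX ht4.le).exists_between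
    (show 1 / (N : ℝ) < psi X (t / 4) from (one_div_lt hp hN0).1 hN1)
  -- The distance of `Y` from `X` is realized only up to `ε`; the loss is absorbed by the
  -- continuity of `θ_Y`.
  obtain ⟨ε, hε⟩ : ∃ ε, ε = theta Y (t / 4) - 1 / N := ⟨_, rfl⟩
  have hε0 : 0 < ε := by linarith
  obtain ⟨T, hT, hTs⟩ := exists_equiv_of_banachMazurDist_le hY hε0
  obtain ⟨_, hdimY, -⟩ := properties_of_equiv T hdim hX
  refine Cz_le_of_one_lt_mul_theta hdimY T ht0 (by linarith) hT hTs ?_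
  have hle : t / (2 * (2 + ε)) ≤ t / 4 :=
    div_le_div_of_nonneg_left ht0.le (by norm_num) (by linarith)
  have hlip := (isConvexlikeModulus_theta hdimY).lip (by positivity) hle (by linarith)
  have hdiff : t / 4 - t / (2 * (2 + ε)) ≤ ε / 2 := by
    rw [div_sub_div _ _ (by norm_num) (by positivity), div_le_iff₀ (by positivity)]
    nlinarith
  rw [← div_lt_iff₀' hN0]
  linarith

end

end AsymptoticModuli

theorem proposition2p8 {X : Type*} [NormedAddCommGroup X] [NormedSpace ℝ X] [CompleteSpace X]
    [TopologicalSpace.SeparableSpace X] (hdim : ¬ FiniteDimensional ℝ X)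
    (hX : ¬ ContainsEllOne X) :
    (MonotoneOn (fun t => rho X t / t) (Ioo 0 1) ∧
      MonotoneOn (fun t => theta X t / t) (Ioo 0 1) ∧
      MonotoneOn (fun t => phi X t / t) (Ioo 0 1) ∧
      MonotoneOn (fun t => psi X t / t) (Ioo 0 1)) ∧
    (Equivalent 4 (theta X) (youngDual (rho X)) ∧
      Equivalent 4 (psi X) (youngDual (phi X))) ∧
    (Equivalent 8 (rho X) (youngDual (theta X)) ∧
      Equivalent 8 (phi X) (youngDual (psi X))) ∧
    (∀ t : ℝ, 0 < t → t ≤ 1 →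
      (Cz X t : ℝ≥0∞) ≤ 1 + 1 / ENNReal.ofReal (psi X (t / 4))) := by
  have h₁ := dualModuli_rho_theta hdim hX
  have h₂ := dualModuli_phi_psi hdim hX
  exact ⟨⟨h₁.left.monotoneOn_div, h₁.right.monotoneOn_div, h₂.left.monotoneOn_div,
    h₂.right.monotoneOn_div⟩, ⟨h₁.equivalent_four, h₂.equivalent_four⟩,
    ⟨h₁.equivalent_eight, h₂.equivalent_eight⟩, fun _ h0 h1 => Cz_le_one_add_inv_psi hdim hX h0 h1⟩
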